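/- **Definitions.** Let $H$ be a locally compact (Hausdorff) hypergroup in the sense of Jewett: the space $M(H)$ of bounded complex Radon measures carries a bilinear associative convolution determined by the point masses, such that $\delta_x*\delta_y$ is a compactly supported Radon probability measure depending weakly continuously on $(x,y)$, its support depends continuously on $(x,y)$ for the Michael (Vietoris) topology, there is an identity $e$, and there is a continuous involution $x\mapsto\check x$ with $(\delta_x*\delta_y)\check{}=\delta_{\check y}*\delta_{\check x}$ and $e\in\operatorname{supp}(\delta_x*\delta_y)\iff x=\check y$. Write $f(x*y)=\int f\,d(\delta_x*\delta_y)$. Let $\lambda$ be a left Haar measure on $H$, i.e. a nonzero Radon measure with $\delta_x*\lambda=\lambda$ for all $x\in H$. A subset of a Banach space is relatively weakly compact if its closure in the weak topology is weakly compact. A function $f\in C_b(H)$ is *weakly almost periodic* if its left orbit $\{\ell_xf: x\in H\}$, $\ell_xf(t)=f(x*t)$, is relatively weakly compact in $C_b(H)$; $wap(H)$ is the set of all such $f$. $L^1(H)=L^1(H,\lambda)$ is the convolution algebra in which $a*b$ is the density of $(a\lambda)*(b\lambda)$, and $L^\infty(H)=L^1(H)^*$. For $f\in L^\infty(H)$ and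 $a\in L^1(H)$ let $a\cdot f\in L^\infty(H)$ be given by $\langle a\cdot f,b\rangle=\langle f,a*b\rangle$ ($b\in L^1(H)$); as a function, $a\cdot f(t)=\int a(y)f(y*t)\,d\lambda(y)$, that is $a\cdot f=\frac1\Delta\check a*f$ with $\Delta$ the modular function. The functional $f$ is *weakly almost periodic on $L^1(H)$* if $\{a\cdot f: a\in L^1(H),\ \|a\|_1\le1\}$ is relatively $\sigma(L^\infty(H),L^\infty(H)^*)$-compact; $WAP(L^1(H))$ is the set of all such functionals. **Proposition.** Let $H$ be a locally compact hypergroup with a left Haar measure $\lambda$. Then $$WAP(L^1(H))=wap(H),$$ where $C_b(H)$ is regarded as a subset of $L^\infty(H)=L^1(H)^*$ through the map $f\mapsto\big(b\mapsto\int_H bf\,d\lambda\big)$. That is, this map is injective on $C_b(H)$, and a functional on $L^1(H)$ is weakly almost periodic if and only if it is the image of a weakly almost periodic function on $H$. -/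

import Mathlib

open MeasureTheory Topology
open scoped BoundedContinuousFunction CompactlySupported ENNReal NNReal

/-- A locally compact hypergroup (Jewett's "convo") on a locally compact Hausdorff space `H` with its
Borel σ-algebra. The convolution of the algebra `M(H)` of bounded Radon measures is given on point
masses, `conv x y = δ_x * δ_y`; the product of two measures is `∫∫ conv x y dμ(x) dν(y)`. -/
class LCHypergroup (H : Type*) [TopologicalSpace H] [T2Space H] [LocallyCompactSpace H]
    [MeasurableSpace H] [BorelSpace H] where
  /-- `conv x y` is the probability measure `δ_x * δ_y`. -/
  conv : H → H → ProbabilityMeasure H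
  /-- the identity element -/
  e : H
  /-- the involution `x ↦ x̌` -/
  invol : H → H
  /-- `δ_x * δ_y` is a Radon measure. -/
  regular_conv : ∀ x y, (conv x y : Measure H).Regular
  /-- `δ_x * δ_y` has compact support. -/
  isCompact_support : ∀ x y, IsCompact (conv x y : Measure H).support
  /-- `(x, y) ↦ δ_x * δ_y` is continuous for the weak topology of probability measures. -/
  continuous_conv : Continuous fun p : H × H => conv p.1 p.2
  /-- `(x, y) ↦ supp (δ_x * δ_y)` is continuous for the Michael (Vietoris) topology on the compact
  subsets of `H`. -/
  continuous_support : Continuous fun p : H × H =>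
    (⟨(conv p.1 p.2 : Measure H).support, isCompact_support p.1 p.2⟩ : TopologicalSpace.Compacts H)
  /-- `(δ_x * δ_y) * δ_z = δ_x * (δ_y * δ_z)`, tested against bounded continuous functions. -/
  assoc : ∀ (x y z : H) (f : H →ᵇ ℂ),
    ∫ u, ∫ t, f t ∂(conv u z : Measure H) ∂(conv x y : Measure H) =
      ∫ v, ∫ t, f t ∂(conv x v : Measure H) ∂(conv y z : Measure H)
  e_conv : ∀ x, (conv e x : Measure H) = Measure.dirac x
  conv_e : ∀ x, (conv x e : Measure H) = Measure.dirac x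
  continuous_invol : Continuous invol
  invol_invol : ∀ x, invol (invol x) = x
  /-- `(δ_x * δ_y)ˇ = δ_y̌ * δ_x̌`. -/
  map_invol_conv : ∀ x y,
    (conv x y : Measure H).map invol = (conv (invol y) (invol x) : Measure H)
  /-- `e ∈ supp (δ_x * δ_y)` exactly when `x = y̌`. -/
  e_mem_support : ∀ x y, e ∈ (conv x y : Measure H).support ↔ x = invol y

namespace LCHypergroup

set_option linter.unusedSectionVars false

variable {H : Type*} [TopologicalSpace H] [T2Space H] [LocallyCompactSpace H]
    [MeasurableSpace H] [BorelSpace H] [LCHypergroup H]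

/-- `f (x * y) = ∫ f d(δ_x * δ_y)`. -/
noncomputable def evalConv {𝕜 : Type*} [RCLike 𝕜] (f : H → 𝕜) (x y : H) : 𝕜 :=
  ∫ t, f t ∂(conv x y : Measure H)

theorem continuous_evalConv {𝕜 : Type*} [RCLike 𝕜] (f : H →ᵇ 𝕜) :
    Continuous fun p : H × H => evalConv f p.1 p.2 := by
  rw [continuous_iff_continuousAt]
  intro p
  exact (ProbabilityMeasure.tendsto_iff_forall_integral_rclike_tendsto 𝕜).1
    (continuous_conv.tendsto p) f

theorem norm_evalConv_le {𝕜 : Type*} [RCLike 𝕜] (f : H →ᵇ 𝕜) (x y : H) : ‖evalConv f x y‖ ≤ ‖f‖ := by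
  refine (norm_integral_le_of_norm_le_const (C := ‖f‖)
    (Filter.Eventually.of_forall fun t => f.norm_coe_le_norm t)).trans ?_
  simp

/-- The left translate `ℓ_x f`, `ℓ_x f (t) = f (x * t)`, of a bounded continuous function. -/
noncomputable def leftTranslate (x : H) (f : H →ᵇ ℂ) : H →ᵇ ℂ :=
  BoundedContinuousFunction.ofNormedAddCommGroup (fun t => evalConv f x t)
    ((continuous_evalConv f).comp (by fun_prop : Continuous fun t : H => (x, t))) ‖f‖
    (fun t => norm_evalConv_le f x t)

/-- A left Haar measure: a nonzero Radon measure `lam` with `δ_x * lam = lam` for all `x`, i.e.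
`∫ f (x * y) dlam(y) = ∫ f dlam` for all nonnegative continuous `f` with compact support. -/
structure IsLeftHaar (lam : Measure H) : Prop where
  regular : lam.Regular
  ne_zero : lam ≠ 0
  left_invariant : ∀ (x : H) (f : C_c(H, ℝ≥0)),
    ∫⁻ y, ∫⁻ t, (f t : ℝ≥0∞) ∂(conv x y : Measure H) ∂lam = ∫⁻ y, (f y : ℝ≥0∞) ∂lam

/-! ### The convolution of `L¹(H)`

The rest of this section proves that the product in `M(H)` of the measures `a·lam` and `b·lam`, with
`a, b ∈ L¹(H)`, is again of the form `c·lam` with a unique `c ∈ L¹(H)`. -/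

section Convolution

open Set Filter

variable {𝕜 : Type*} [RCLike 𝕜]

theorem integrable_mul_of_bounded {lam : Measure H} {b G : H → 𝕜} (hb : Integrable b lam)
    (hG : Continuous G) {M : ℝ} (hM : ∀ y, ‖G y‖ ≤ M) : Integrable (fun y => b y * G y) lam :=
  hb.mul_bdd (c := M) hG.aestronglyMeasurable (Eventually.of_forall hM)

theorem norm_integral_mul_le {lam : Measure H} {b G : H → 𝕜} (hb : Integrable b lam)
    {M : ℝ} (hM : ∀ y, ‖G y‖ ≤ M) : ‖∫ y, b y * G y ∂lam‖ ≤ M * ∫ y, ‖b y‖ ∂lam := by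
  rw [← integral_const_mul]
  refine norm_integral_le_of_norm_le (hb.norm.const_mul M) (Eventually.of_forall fun y => ?_)
  rw [norm_mul, mul_comm]
  exact mul_le_mul_of_nonneg_right (hM y) (norm_nonneg _)

theorem continuous_integral_mul {lam : Measure H} [lam.Regular] {G : H → H → 𝕜}
    (hG : Continuous (Function.uncurry G)) {M : ℝ} (hM : ∀ x y, ‖G x y‖ ≤ M) {b : H → 𝕜}
    (hb : Integrable b lam) : Continuous fun x => ∫ y, b y * G x y ∂lam := by
  have hGx : ∀ x, Continuous (G x) := fun x => hG.comp (by fun_prop : Continuous fun y => (x, y))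
  have hM0 : ∀ x : H, 0 ≤ M := fun x => (norm_nonneg _).trans (hM x x)
  -- a uniform approximation principle
  have key : ∀ b : H → 𝕜, Integrable b lam →
      (∀ ε > 0, ∃ b' : H → 𝕜, Integrable b' lam ∧ ∫ y, ‖b y - b' y‖ ∂lam ≤ ε ∧
        Continuous fun x => ∫ y, b' y * G x y ∂lam) →
      Continuous fun x => ∫ y, b y * G x y ∂lam := by
    intro b hb h
    refine Metric.continuous_iff'.2 fun x₀ ε hε => ?_
    have hM0 := hM0 x₀
    obtain ⟨b', hb', hle, hc⟩ := h (ε / (3 * (M + 1))) (by positivity)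
    have hbd : ∀ x, ‖∫ y, b y * G x y ∂lam - ∫ y, b' y * G x y ∂lam‖ < ε / 3 := by
      intro x
      rw [← integral_sub (integrable_mul_of_bounded hb (hGx x) (hM x))
        (integrable_mul_of_bounded hb' (hGx x) (hM x))]
      simp only [← sub_mul]
      refine (norm_integral_mul_le (hb.sub hb') (hM x)).trans_lt ?_
      calc M * ∫ y, ‖b y - b' y‖ ∂lam ≤ M * (ε / (3 * (M + 1))) := by gcongr
        _ < (M + 1) * (ε / (3 * (M + 1))) := by gcongr; linarith
        _ = ε / 3 := by field_simp
    filter_upwards [Metric.continuous_iff'.1 hc x₀ (ε / 3) (by positivity)] with x hx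
    rw [dist_eq_norm] at hx ⊢
    have h1 := hbd x
    have h2 := hbd x₀
    rw [norm_sub_rev] at h2
    calc _ = ‖(∫ y, b y * G x y ∂lam - ∫ y, b' y * G x y ∂lam) +
          (∫ y, b' y * G x y ∂lam - ∫ y, b' y * G x₀ y ∂lam) +
          (∫ y, b' y * G x₀ y ∂lam - ∫ y, b y * G x₀ y ∂lam)‖ := by congr 1; ring
      _ < ε / 3 + ε / 3 + ε / 3 := (norm_add₃_le).trans_lt (by gcongr)
      _ = ε := by ring
  refine Integrable.induction (P := fun b => Continuous fun x => ∫ y, b y * G x y ∂lam) ?_ ?_ ?_ ?_ hb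
  · intro c s hs hsfin
    refine key _ ((integrable_indicator_iff hs).2 (integrableOn_const hsfin.ne)) fun ε hε => ?_
    obtain ⟨K, hKs, hK, hlt⟩ := hs.exists_isCompact_sdiff_lt hsfin.ne
      (ENNReal.ofReal_pos.2 (by positivity : 0 < ε / (‖c‖ + 1))).ne'
    have hKm := hK.measurableSet
    have hKfin : lam K ≠ ∞ := hK.measure_lt_top.ne
    refine ⟨K.indicator fun _ => c, (integrable_indicator_iff hKm).2 (integrableOn_const hKfin),
      ?_, ?_⟩
    · have : ∀ y, ‖s.indicator (fun _ => c) y - K.indicator (fun _ => c) y‖ =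
          (s \ K).indicator (fun _ => ‖c‖) y := by
        intro y
        by_cases h1 : y ∈ K
        · simp [h1, hKs h1]
        · by_cases h2 : y ∈ s <;> simp [h1, h2]
      simp_rw [this]
      rw [integral_indicator (hs.diff hKm)]
      simp only [integral_const, smul_eq_mul, measureReal_restrict_apply_univ]
      have : lam.real (s \ K) ≤ ε / (‖c‖ + 1) :=
        ENNReal.toReal_le_of_le_ofReal (by positivity) hlt.le
      calc lam.real (s \ K) * ‖c‖ ≤ ε / (‖c‖ + 1) * (‖c‖ + 1) := by gcongr; linarith
        _ = ε := by field_simp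
    · obtain ⟨χ, hχ1, -, hχc, -⟩ := exists_continuous_one_zero_of_isCompact hK isClosed_empty
        (disjoint_empty K)
      have := (continuousOn_univ.1 <| continuousOn_integral_of_compact_support
        (μ := lam.restrict K) (f := fun x y => c * (χ y * G x y)) (s := univ) hχc.isCompact
        (Continuous.continuousOn (by unfold Function.uncurry at *; fun_prop)) (fun p y _ hy => by
          simp [image_eq_zero_of_notMem_tsupport hy]))
      convert this using 2 with x
      rw [← integral_indicator hKm]
      congr 1 with y
      by_cases h1 : y ∈ K
      · simp [h1, hχ1 h1]
      · simp [h1]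
  · intro f g _ hf hg h1 h2
    convert h1.add h2 using 2 with x
    rw [Pi.add_apply, ← integral_add (integrable_mul_of_bounded hf (hGx x) (hM x))
        (integrable_mul_of_bounded hg (hGx x) (hM x))]
    simp [add_mul]
  · refine isClosed_of_closure_subset fun f hf => ?_
    refine key _ (L1.integrable_coeFn f) fun ε hε => ?_
    obtain ⟨f', hf', hd⟩ := Metric.mem_closure_iff.1 hf ε hε
    refine ⟨f', L1.integrable_coeFn f', ?_, hf'⟩
    rw [dist_eq_norm, L1.norm_eq_integral_norm] at hd
    refine le_trans (le_of_eq ?_) hd.le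
    refine integral_congr_ae ?_
    filter_upwards [Lp.coeFn_sub f f'] with y hy
    rw [hy]; simp
  · intro f g hfg _ h
    convert h using 2 with x
    refine integral_congr_ae ?_
    filter_upwards [hfg] with y hy
    rw [hy]

theorem continuous_uncurry_evalConv (f : C_c(H, 𝕜)) :
    Continuous (Function.uncurry (evalConv (H := H) f)) :=
  continuous_evalConv (f : BoundedContinuousFunction H 𝕜)

theorem integrable_conv (f : C_c(H, 𝕜)) (x y : H) : Integrable f (conv x y : Measure H) :=
  f.continuous.integrable_of_hasCompactSupport f.hasCompactSupport

theorem exists_bound_evalConv (f : C_c(H, 𝕜)) : ∃ M, ∀ x y, ‖evalConv (H := H) f x y‖ ≤ M :=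
  ⟨_, norm_evalConv_le (f : BoundedContinuousFunction H 𝕜)⟩

/-- The functional `g ↦ ∫∫ α(x) β(y) g(x * y)`: the product of `α·lam` and `β·lam` in `M(H)`. -/
noncomputable def convFunctional (lam : Measure H) (α β : H → 𝕜) (g : H → 𝕜) : 𝕜 :=
  ∫ x, α x * ∫ y, β y * evalConv g x y ∂lam ∂lam

theorem integrable_inner {lam : Measure H} {β : H → 𝕜} (hβ : Integrable β lam) (g : C_c(H, 𝕜))
    (x : H) : Integrable (fun y => β y * evalConv g x y) lam := by
  obtain ⟨M, hM⟩ := exists_bound_evalConv g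
  exact integrable_mul_of_bounded hβ
    ((continuous_uncurry_evalConv g).comp (by fun_prop : Continuous fun y => (x, y))) (hM x)

theorem integrable_outer {lam : Measure H} [lam.Regular] {α β : H → 𝕜} (hα : Integrable α lam)
    (hβ : Integrable β lam) (g : C_c(H, 𝕜)) :
    Integrable (fun x => α x * ∫ y, β y * evalConv g x y ∂lam) lam := by
  obtain ⟨M, hM⟩ := exists_bound_evalConv g
  exact integrable_mul_of_bounded hα (continuous_integral_mul (continuous_uncurry_evalConv g) hM hβ)
    (fun x => norm_integral_mul_le hβ (hM x))

theorem convFunctional_add {lam : Measure H} [lam.Regular] {α β : H → 𝕜} (hα : Integrable α lam)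
    (hβ : Integrable β lam) (f g : C_c(H, 𝕜)) :
    convFunctional lam α β (f + g) = convFunctional lam α β f + convFunctional lam α β g := by
  unfold convFunctional
  rw [← integral_add (integrable_outer hα hβ f) (integrable_outer hα hβ g)]
  congr 1 with x
  rw [← mul_add, ← integral_add (integrable_inner hβ f x) (integrable_inner hβ g x)]
  congr 2 with y
  rw [← mul_add]
  congr 1
  exact integral_add (integrable_conv f x y) (integrable_conv g x y)

theorem convFunctional_smul {lam : Measure H} {α β : H → 𝕜} (r : 𝕜) (f : H → 𝕜) :
    convFunctional lam α β (fun t => r * f t) = r * convFunctional lam α β f := by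
  unfold convFunctional evalConv
  simp only [integral_const_mul, mul_left_comm _ r]

theorem convFunctional_nonneg {lam : Measure H} {α β : H → ℝ} (hα0 : ∀ x, 0 ≤ α x)
    (hβ0 : ∀ x, 0 ≤ β x) {f : H → ℝ} (hf : ∀ t, 0 ≤ f t) : 0 ≤ convFunctional lam α β f :=
  integral_nonneg fun x => mul_nonneg (hα0 x) <| integral_nonneg fun y =>
    mul_nonneg (hβ0 y) <| integral_nonneg fun t => hf t

/-- `convFunctional` as a positive linear functional on `C_c(H, ℝ)`. -/
noncomputable def convPos {lam : Measure H} [lam.Regular] {α β : H → ℝ} (hα : Integrable α lam)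
    (hβ : Integrable β lam) (hα0 : ∀ x, 0 ≤ α x) (hβ0 : ∀ x, 0 ≤ β x) : C_c(H, ℝ) →ₚ[ℝ] ℝ :=
  PositiveLinearMap.mk₀
    { toFun := fun g => convFunctional lam α β g
      map_add' := fun f g => by
        rw [← convFunctional_add hα hβ]; rfl
      map_smul' := fun r f => convFunctional_smul r f }
    (fun f hf => convFunctional_nonneg hα0 hβ0 hf)

theorem lintegral_evalConv {lam : Measure H} (h : IsLeftHaar lam) (f : C_c(H, ℝ))
    (hf : ∀ t, 0 ≤ f t) (x : H) :
    ∫⁻ y, ENNReal.ofReal (evalConv f x y) ∂lam = ∫⁻ y, ENNReal.ofReal (f y) ∂lam := by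
  have := h.left_invariant x f.nnrealPart
  simp only [CompactlySupportedContinuousMap.nnrealPart_apply] at this
  change _ = ∫⁻ y, ((f y).toNNReal : ℝ≥0∞) ∂lam
  rw [← this]
  refine lintegral_congr fun y => ?_
  rw [evalConv, ofReal_integral_eq_lintegral_ofReal (integrable_conv f x y)
    (Eventually.of_forall hf)]
  rfl

theorem convFunctional_le {lam : Measure H} (h : IsLeftHaar lam) {α β : H → ℝ}
    (hα : Integrable α lam)
    (hβ : Integrable β lam) (hα0 : ∀ x, 0 ≤ α x) (hβ0 : ∀ x, 0 ≤ β x) (f : C_c(H, ℝ))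
    (hf0 : ∀ t, 0 ≤ f t) (hf1 : ∀ t, f t ≤ 1) {N : ℝ} (hN : 0 ≤ N) :
    convFunctional lam α β f ≤
      (N * ∫ y, f y ∂lam + ∫ y, max (β y - N) 0 ∂lam) * ∫ x, α x ∂lam := by
  have := h.regular
  have hE0 : ∀ x y, 0 ≤ evalConv f x y := fun x y => integral_nonneg fun t => hf0 t
  have hE1 : ∀ x y, evalConv f x y ≤ 1 := fun x y => by
    have := integral_mono (integrable_conv f x y) (integrable_const 1) hf1
    simpa [evalConv] using this
  have hfi : Integrable f lam := f.continuous.integrable_of_hasCompactSupport f.hasCompactSupport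
  have hEc : ∀ x, Continuous (evalConv f x) := fun x =>
    (continuous_uncurry_evalConv f).comp (by fun_prop : Continuous fun y => (x, y))
  have hEi : ∀ x, Integrable (evalConv f x) lam := fun x => by
    refine ⟨(hEc x).aestronglyMeasurable, ?_⟩
    rw [hasFiniteIntegral_iff_ofReal (Eventually.of_forall (hE0 x)), lintegral_evalConv h f hf0,
      ← ofReal_integral_eq_lintegral_ofReal hfi (Eventually.of_forall hf0)]
    exact ENNReal.ofReal_lt_top
  have hEint : ∀ x, ∫ y, evalConv f x y ∂lam = ∫ y, f y ∂lam := fun x => by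
    rw [integral_eq_lintegral_of_nonneg_ae (Eventually.of_forall (hE0 x))
      (hEc x).aestronglyMeasurable, lintegral_evalConv h f hf0,
      ← integral_eq_lintegral_of_nonneg_ae (Eventually.of_forall hf0)
        f.continuous.aestronglyMeasurable]
  have hmax : Integrable (fun y => max (β y - N) 0) lam := by
    refine hβ.mono' ((hβ.1.sub aestronglyMeasurable_const).sup aestronglyMeasurable_const)
      (Eventually.of_forall fun y => ?_)
    have := hβ0 y
    rw [Real.norm_eq_abs, abs_of_nonneg (le_max_right _ _)]
    exact max_le (by linarith) this
  unfold convFunctional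
  rw [← integral_const_mul]
  refine integral_mono (integrable_outer hα hβ f) (hα.const_mul _) fun x => ?_
  rw [mul_comm]
  refine mul_le_mul_of_nonneg_right ?_ (hα0 x)
  rw [← hEint x, ← integral_const_mul, ← integral_add ((hEi x).const_mul N) hmax]
  refine integral_mono (integrable_inner hβ f x) (((hEi x).const_mul N).add hmax) fun y => ?_
  have h1 := hE0 x y
  have h2 := hE1 x y
  have h3 := le_max_left (β y - N) 0
  have h4 := le_max_right (β y - N) 0
  nlinarith

theorem tendsto_integral_max {lam : Measure H} {β : H → ℝ}
    (hβ : Integrable β lam) (hβ0 : ∀ x, 0 ≤ β x) :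
    Tendsto (fun N : ℕ => ∫ y, max (β y - N) 0 ∂lam) atTop (𝓝 0) := by
  have := tendsto_integral_of_dominated_convergence (μ := lam) (f := fun _ => (0 : ℝ))
    (F := fun (N : ℕ) y => max (β y - N) 0) β
    (fun N => (hβ.1.sub aestronglyMeasurable_const).sup aestronglyMeasurable_const) hβ
    (fun N => Eventually.of_forall fun y => ?_) (Eventually.of_forall fun y => ?_)
  · simpa using this
  · have h := hβ0 y
    have : (0 : ℝ) ≤ N := N.cast_nonneg
    rw [Real.norm_eq_abs, abs_of_nonneg (le_max_right _ _)]
    exact max_le (by linarith) h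
  · refine tendsto_const_nhds.congr' ?_
    obtain ⟨n, hn⟩ := exists_nat_ge (β y)
    filter_upwards [eventually_ge_atTop n] with N hN
    have : (n : ℝ) ≤ N := by exact_mod_cast hN
    rw [max_eq_right (by linarith)]

/-- The product in `M(H)` of two positive `L¹` measures is an `L¹` measure. -/
theorem exists_density {lam : Measure H} (h : IsLeftHaar lam) {α β : H → ℝ}
    (hα : Integrable α lam)
    (hβ : Integrable β lam) (hα0 : ∀ x, 0 ≤ α x) (hβ0 : ∀ x, 0 ≤ β x) :
    ∃ c : H → ℝ, Integrable c lam ∧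
      ∀ g : C_c(H, ℝ), ∫ z, c z * g z ∂lam = convFunctional lam α β g := by
  have := h.regular
  set Λ := convPos hα hβ hα0 hβ0 with hΛ
  have hΛg : ∀ g, Λ g = convFunctional lam α β g := fun g => rfl
  set ν := RealRMK.rieszMeasure Λ with hν
  have hνg : ∀ g : C_c(H, ℝ), ∫ z, g z ∂ν = convFunctional lam α β g :=
    fun g => RealRMK.integral_rieszMeasure Λ g
  have hreg : ν.Regular := inferInstance
  have hA : 0 ≤ ∫ x, α x ∂lam := integral_nonneg hα0
  have hB : 0 ≤ ∫ x, β x ∂lam := integral_nonneg hβ0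
  -- total mass
  have hfin : IsFiniteMeasure ν := by
    refine ⟨lt_of_le_of_lt ?_ (ENNReal.ofReal_lt_top (r := (∫ y, β y ∂lam) * ∫ x, α x ∂lam))⟩
    rw [isOpen_univ.measure_eq_iSup_isCompact]
    refine iSup₂_le fun K _ => iSup_le fun hK => ?_
    obtain ⟨χ, hχ1, -, hχc, hχ⟩ := exists_continuous_one_zero_of_isCompact hK isClosed_empty
        (disjoint_empty K)
    refine (RealRMK.rieszMeasure_le_of_eq_one Λ (f := ⟨χ, hχc⟩) (fun x => (hχ x).1) hK
      (fun x hx => hχ1 hx)).trans (ENNReal.ofReal_le_ofReal ?_)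
    have := convFunctional_le h hα hβ hα0 hβ0 ⟨χ, hχc⟩ (fun x => (hχ x).1) (fun x => (hχ x).2) le_rfl
    rw [hΛg]
    refine this.trans (le_of_eq ?_)
    simp [max_eq_left (hβ0 _)]
  -- compact null sets
  have hnull : ∀ K, IsCompact K → lam K = 0 → ν K = 0 := by
    intro K hK hK0
    refine le_antisymm (ENNReal.le_of_forall_pos_le_add fun ε hε _ => ?_) zero_le
    rw [zero_add]
    have hlim := (tendsto_integral_max hβ hβ0).mul_const (∫ x, α x ∂lam)
    rw [zero_mul] at hlim
    have hε' : (0 : ℝ) < ε := hε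
    obtain ⟨N, hN⟩ := (hlim.eventually (gt_mem_nhds (half_pos hε'))).exists
    set δ : ℝ := ε / 2 / ((N + 1) * (∫ x, α x ∂lam + 1)) with hδ
    have hδ0 : 0 < δ := by positivity
    obtain ⟨U, hKU, hU, hlU⟩ := K.exists_isOpen_lt_of_lt (μ := lam) (ENNReal.ofReal δ)
      (by rw [hK0]; exact ENNReal.ofReal_pos.2 hδ0)
    obtain ⟨χ, hχ1, hχ0, hχc, hχ⟩ := exists_continuous_one_zero_of_isCompact hK hU.isClosed_compl
        (disjoint_compl_right_iff_subset.2 hKU)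
    have hle := RealRMK.rieszMeasure_le_of_eq_one Λ (f := ⟨χ, hχc⟩) (fun x => (hχ x).1) hK
      (fun x hx => hχ1 hx)
    refine hle.trans ?_
    rw [← ENNReal.ofReal_coe_nnreal]
    refine ENNReal.ofReal_le_ofReal ?_
    refine (convFunctional_le h hα hβ hα0 hβ0 ⟨χ, hχc⟩ (fun x => (hχ x).1) (fun x => (hχ x).2)
      N.cast_nonneg).trans ?_
    have hχint : ∫ y, χ y ∂lam ≤ δ := by
      calc ∫ y, χ y ∂lam ≤ ∫ y, U.indicator 1 y ∂lam := by
            refine integral_mono (χ.continuous.integrable_of_hasCompactSupport hχc)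
              ((integrable_indicator_iff hU.measurableSet).2
                (integrableOn_const (hlU.trans ENNReal.ofReal_lt_top).ne)) fun y => ?_
            by_cases hy : y ∈ U
            · simpa [hy] using (hχ y).2
            · simpa [hy] using (hχ0 hy).le
        _ = lam.real U := by rw [integral_indicator_one hU.measurableSet]
        _ ≤ δ := ENNReal.toReal_le_of_le_ofReal hδ0.le hlU.le
    change (N * ∫ y, χ y ∂lam + _) * _ ≤ (ε : ℝ)
    rw [add_mul]
    have : N * (∫ y, χ y ∂lam) * ∫ x, α x ∂lam ≤ ε / 2 := by
      calc N * (∫ y, χ y ∂lam) * ∫ x, α x ∂lam ≤ (N + 1) * δ * (∫ x, α x ∂lam + 1) := by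
            have : 0 ≤ ∫ y, χ y ∂lam := integral_nonneg fun y => (hχ y).1
            gcongr <;> linarith
        _ = ε / 2 := by rw [hδ]; field_simp
    linarith
  have hac : ν ≪ lam := by
    refine Measure.AbsolutelyContinuous.mk fun s hs hs0 => ?_
    rw [hs.measure_eq_iSup_isCompact_of_ne_top (measure_ne_top ν s)]
    simp only [ENNReal.iSup_eq_zero]
    exact fun K hKs hK => hnull K hK (measure_mono_null hKs hs0)
  -- `ν` lives on a σ-compact set
  have hK : ∀ n : ℕ, ∃ K, IsCompact K ∧ ν univ < ν K + ((n : ℝ≥0∞) + 1)⁻¹ := fun n => by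
    obtain ⟨K, -, hK, hlt⟩ := MeasurableSet.univ.exists_isCompact_lt_add (measure_ne_top ν univ)
      (ε := ((n : ℝ≥0∞) + 1)⁻¹) (by simp [ENNReal.inv_eq_zero])
    exact ⟨K, hK, hlt⟩
  choose K hKc hKlt using hK
  set S := ⋃ n, K n with hS
  have hSm : MeasurableSet S := MeasurableSet.iUnion fun n => (hKc n).measurableSet
  have hSc : ν Sᶜ = 0 := by
    rw [measure_compl hSm (measure_ne_top ν S), tsub_eq_zero_iff_le]
    refine ENNReal.le_of_forall_pos_le_add fun ε hε _ => ?_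
    obtain ⟨n, hn⟩ := ENNReal.exists_inv_nat_lt (ENNReal.coe_pos.2 hε).ne'
    refine (hKlt n).le.trans (add_le_add (measure_mono (subset_iUnion K n)) (le_trans ?_ hn.le))
    exact ENNReal.inv_le_inv.2 le_self_add
  have hσ : SigmaFinite (lam.restrict S) := by
    refine Measure.sigmaFinite_of_countable (S := insert Sᶜ (range K)) (by simp [countable_range]) ?_ ?_
    · rintro s (rfl | ⟨n, rfl⟩)
      · simp [Measure.restrict_apply hSm.compl]
      · exact (Measure.restrict_apply_le _ _).trans_lt (hKc n).measure_lt_top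
    · simp [sUnion_insert, sUnion_range, ← hS]
  have hac' : ν ≪ lam.restrict S := by
    refine Measure.AbsolutelyContinuous.mk fun s hs hs0 => ?_
    rw [Measure.restrict_apply hs] at hs0
    exact measure_mono_null (fun x hx => (em (x ∈ S)).imp (fun h => ⟨hx, h⟩) id)
      (measure_union_null (hac hs0) hSc)
  have hden := Measure.withDensity_rnDeriv_eq ν (lam.restrict S) hac'
  refine ⟨S.indicator fun z => (ν.rnDeriv (lam.restrict S) z).toReal,
    (integrable_indicator_iff hSm).2 Measure.integrable_toReal_rnDeriv, fun g => ?_⟩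
  rw [← hνg g]
  conv_rhs => rw [← hden]
  rw [integral_withDensity_eq_integral_toReal_smul (Measure.measurable_rnDeriv _ _)
    (Measure.rnDeriv_lt_top _ _), ← integral_indicator hSm]
  congr 1 with z
  by_cases hz : z ∈ S <;> simp [hz]

/-- The product of `a·lam` and `b·lam` in `M(H)` is `c·lam` for some integrable `c`. -/
def HasDensity (lam : Measure H) (a b : H → ℂ) : Prop :=
  ∃ c : H → ℂ, Integrable c lam ∧
    ∀ g : C_c(H, ℂ), ∫ z, c z * g z ∂lam = convFunctional lam a b g

theorem hasDensity_ofReal {lam : Measure H} (h : IsLeftHaar lam) {α β : H → ℝ}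
    (hα : Integrable α lam)
    (hβ : Integrable β lam) (hα0 : ∀ x, 0 ≤ α x) (hβ0 : ∀ x, 0 ≤ β x) :
    HasDensity lam (fun x => (α x : ℂ)) (fun x => (β x : ℂ)) := by
  have := h.regular
  obtain ⟨c, hc, hcg⟩ := exists_density h hα hβ hα0 hβ0
  refine ⟨fun x => (c x : ℂ), hc.ofReal, fun g => ?_⟩
  set u : C_c(H, ℝ) := g.compLeft ⟨Complex.re, Complex.continuous_re⟩ with hu
  set v : C_c(H, ℝ) := g.compLeft ⟨Complex.im, Complex.continuous_im⟩ with hv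
  have hu' : ∀ t, u t = (g t).re := fun t => by simp [hu, CompactlySupportedContinuousMap.compLeft_apply]
  have hv' : ∀ t, v t = (g t).im := fun t => by simp [hv, CompactlySupportedContinuousMap.compLeft_apply]
  have hgt : ∀ t, g t = (u t : ℂ) + Complex.I * (v t : ℂ) := fun t => by
    rw [hu', hv', mul_comm, Complex.re_add_im]
  have hu0 := hcg u
  have hv0 := hcg v
  have e1 : ∀ w : C_c(H, ℝ), Integrable (fun z => (c z : ℂ) * (w z : ℂ)) lam := fun w => by
    obtain ⟨M, hM⟩ := w.continuous.bounded_above_of_compact_support w.hasCompactSupport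
    exact_mod_cast (integrable_mul_of_bounded hc w.continuous hM).ofReal (𝕜 := ℂ)
  have e2 : ∀ x y, evalConv g x y = ((evalConv u x y : ℝ) : ℂ) + Complex.I * ((evalConv v x y : ℝ) : ℂ) := by
    intro x y
    unfold evalConv
    rw [← integral_complex_ofReal, ← integral_complex_ofReal, ← integral_const_mul,
      ← integral_add (integrable_conv u x y).ofReal ((integrable_conv v x y).ofReal.const_mul _)]
    simp_rw [hgt]
  have e3 : ∀ (w : C_c(H, ℝ)) x, Integrable (fun y => (β y : ℂ) * ((evalConv w x y : ℝ) : ℂ)) lam :=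
    fun w x => by exact_mod_cast (integrable_inner hβ w x).ofReal (𝕜 := ℂ)
  have e4 : ∀ (w : C_c(H, ℝ)), Integrable
      (fun x => (α x : ℂ) * ∫ y, (β y : ℂ) * ((evalConv w x y : ℝ) : ℂ) ∂lam) lam := fun w => by
    have := (integrable_outer hα hβ w).ofReal (𝕜 := ℂ)
    convert this using 2 with x
    rw [RCLike.ofReal_mul, ← integral_ofReal]
    simp
  have e5 : ∀ w : C_c(H, ℝ), ∫ z, (c z : ℂ) * (w z : ℂ) ∂lam =
      ∫ x, (α x : ℂ) * ∫ y, (β y : ℂ) * ((evalConv w x y : ℝ) : ℂ) ∂lam ∂lam := fun w => by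
    have := congrArg (fun r : ℝ => (r : ℂ)) (hcg w)
    simp only [convFunctional] at this
    simp only [← integral_complex_ofReal, Complex.ofReal_mul] at this
    exact this
  unfold convFunctional
  simp_rw [hgt, e2, mul_add, mul_left_comm _ Complex.I]
  rw [integral_add (e1 u) ((e1 v).const_mul _), integral_const_mul, e5, e5]
  have e6 : ∀ x, ∫ y, ((β y : ℂ) * ((evalConv u x y : ℝ) : ℂ) +
      Complex.I * ((β y : ℂ) * ((evalConv v x y : ℝ) : ℂ))) ∂lam =
      ∫ y, (β y : ℂ) * ((evalConv u x y : ℝ) : ℂ) ∂lam +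
      Complex.I * ∫ y, (β y : ℂ) * ((evalConv v x y : ℝ) : ℂ) ∂lam := fun x => by
    rw [integral_add (e3 u x) ((e3 v x).const_mul _), integral_const_mul]
  simp_rw [e6, mul_add, mul_left_comm _ Complex.I]
  rw [integral_add (e4 u) ((e4 v).const_mul _), integral_const_mul]

theorem integrable_mul_cc {lam : Measure H} {c : H → ℂ} (hc : Integrable c lam) (g : C_c(H, ℂ)) :
    Integrable (fun z => c z * g z) lam := by
  obtain ⟨M, hM⟩ := g.continuous.bounded_above_of_compact_support g.hasCompactSupport
  exact integrable_mul_of_bounded hc g.continuous hM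

theorem HasDensity.left {lam : Measure H} [lam.Regular] {a a' b : H → ℂ} (ha : Integrable a lam)
    (ha' : Integrable a' lam) (hb : Integrable b lam) (r : ℂ) (h : HasDensity lam a b)
    (h' : HasDensity lam a' b) : HasDensity lam (fun x => a x + r * a' x) b := by
  obtain ⟨c, hc, hg⟩ := h
  obtain ⟨c', hc', hg'⟩ := h'
  refine ⟨fun x => c x + r * c' x, hc.add (hc'.const_mul r), fun g => ?_⟩
  simp only [add_mul, mul_assoc, convFunctional]
  rw [integral_add (integrable_mul_cc hc g) ((integrable_mul_cc hc' g).const_mul r),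
    integral_const_mul, hg, hg',
    integral_add (integrable_outer ha hb g) ((integrable_outer ha' hb g).const_mul r),
    integral_const_mul]
  rfl

theorem HasDensity.right {lam : Measure H} [lam.Regular] {a b b' : H → ℂ} (ha : Integrable a lam)
    (hb : Integrable b lam) (hb' : Integrable b' lam) (r : ℂ) (h : HasDensity lam a b)
    (h' : HasDensity lam a b') : HasDensity lam a (fun x => b x + r * b' x) := by
  obtain ⟨c, hc, hg⟩ := h
  obtain ⟨c', hc', hg'⟩ := h'
  refine ⟨fun x => c x + r * c' x, hc.add (hc'.const_mul r), fun g => ?_⟩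
  have e : ∀ x, ∫ y, (b y + r * b' y) * evalConv g x y ∂lam =
      ∫ y, b y * evalConv g x y ∂lam + r * ∫ y, b' y * evalConv g x y ∂lam := fun x => by
    simp only [add_mul, mul_assoc]
    rw [integral_add (integrable_inner hb g x) ((integrable_inner hb' g x).const_mul r),
      integral_const_mul]
  unfold convFunctional
  simp_rw [e, mul_add, mul_left_comm _ r]
  simp only [add_mul, mul_assoc]
  rw [integral_add (integrable_mul_cc hc g) ((integrable_mul_cc hc' g).const_mul r),
    integral_const_mul, hg, hg',
    integral_add (integrable_outer ha hb g) ((integrable_outer ha hb' g).const_mul r),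
    integral_const_mul]
  rfl

theorem decompose (a : H → ℂ) : a = fun x => (((((max (a x).re 0 : ℝ) : ℂ) +
    (-1) * ((max (-(a x).re) 0 : ℝ) : ℂ)) + Complex.I * ((max (a x).im 0 : ℝ) : ℂ)) +
    (-Complex.I) * ((max (-(a x).im) 0 : ℝ) : ℂ)) := by
  funext x
  have e : ∀ r : ℝ, max r 0 - max (-r) 0 = r := fun r => by
    rcases le_total r 0 with h | h
    · rw [max_eq_right h, max_eq_left (by linarith)]; ring
    · rw [max_eq_left h, max_eq_right (by linarith)]; ring
  apply Complex.ext
  · simp only [Complex.add_re, Complex.mul_re, Complex.neg_re, Complex.ofReal_re, Complex.ofReal_im,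
      Complex.I_re, Complex.I_im, Complex.one_re, Complex.neg_im, Complex.one_im]
    linarith [e (a x).re]
  · simp only [Complex.add_im, Complex.mul_im, Complex.neg_re, Complex.ofReal_re, Complex.ofReal_im,
      Complex.I_re, Complex.I_im, Complex.one_re, Complex.neg_im, Complex.one_im]
    linarith [e (a x).im]

theorem hasDensity {lam : Measure H} (h : IsLeftHaar lam) {a b : H → ℂ}
    (ha : Integrable a lam) (hb : Integrable b lam) : HasDensity lam a b := by
  have := h.regular
  have p : ∀ {r : H → ℝ}, Integrable r lam → Integrable (fun x => max (r x) 0) lam :=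
    fun hr => hr.pos_part
  have q : ∀ {r : H → ℝ}, Integrable r lam → Integrable (fun x => ((max (r x) 0 : ℝ) : ℂ)) lam :=
    fun hr => (p hr).ofReal
  have n : ∀ (r : H → ℝ) x, 0 ≤ max (r x) 0 := fun r x => le_max_right _ _
  have step : ∀ {r : H → ℝ}, Integrable r lam →
      HasDensity lam (fun x => ((max (r x) 0 : ℝ) : ℂ)) b := by
    intro r hr
    have hre := hb.re
    have him := hb.im
    rw [decompose b]
    have i1 := q hre
    have i2 := q hre.neg
    have i3 := q him
    have i4 := q him.neg
    exact HasDensity.right (q hr) ((i1.add (i2.const_mul _)).add (i3.const_mul _)) i4 _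
      (HasDensity.right (q hr) (i1.add (i2.const_mul _)) i3 _
        (HasDensity.right (q hr) i1 i2 _
          (hasDensity_ofReal h (p hr) (p hre) (n _) (n _))
          (hasDensity_ofReal h (p hr) (p hre.neg) (n _) (n _)))
        (hasDensity_ofReal h (p hr) (p him) (n _) (n _)))
      (hasDensity_ofReal h (p hr) (p him.neg) (n _) (n _))
  have hre := ha.re
  have him := ha.im
  rw [decompose a]
  have i1 := q hre
  have i2 := q hre.neg
  have i3 := q him
  have i4 := q him.neg
  exact HasDensity.left ((i1.add (i2.const_mul _)).add (i3.const_mul _)) i4 hb _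
    (HasDensity.left (i1.add (i2.const_mul _)) i3 hb _
      (HasDensity.left i1 i2 hb _ (step hre) (step hre.neg)) (step him)) (step him.neg)

/-- `c` is the convolution `a * b` of `a, b ∈ L¹(H)`: the measure `c·lam` is the product of the
measures `a·lam` and `b·lam` in `M(H)`. -/
def IsL1Conv (lam : Measure H) (a b c : Lp ℂ 1 lam) : Prop :=
  ∀ g : C_c(H, ℂ), ∫ z, c z * g z ∂lam = ∫ x, a x * ∫ y, b y * evalConv g x y ∂lam ∂lam

theorem exists_isL1Conv {lam : Measure H} (h : IsLeftHaar lam) (a b : Lp ℂ 1 lam) :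
    ∃ c, IsL1Conv lam a b c := by
  obtain ⟨c, hc, hg⟩ := hasDensity h (L1.integrable_coeFn a) (L1.integrable_coeFn b)
  refine ⟨hc.toL1 c, fun g => ?_⟩
  refine Eq.trans (integral_congr_ae ?_) (hg g)
  filter_upwards [hc.coeFn_toL1] with z hz
  rw [hz]


theorem IsL1Conv.unique {lam : Measure H} (h : IsLeftHaar lam) {a b c c' : Lp ℂ 1 lam}
    (hc : IsL1Conv lam a b c) (hc' : IsL1Conv lam a b c') : c = c' := by
  have := h.regular
  have hd : Integrable (c - c' : Lp ℂ 1 lam) lam := L1.integrable_coeFn _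
  have hz : ∀ g : C_c(H, ℂ), ∫ z, (c - c' : Lp ℂ 1 lam) z * g z ∂lam = 0 := fun g => by
    have e : ∫ z, (c - c' : Lp ℂ 1 lam) z * g z ∂lam = ∫ z, (c z * g z - c' z * g z) ∂lam := by
      refine integral_congr_ae ?_
      filter_upwards [Lp.coeFn_sub c c'] with z hz
      rw [hz, Pi.sub_apply, sub_mul]
    rw [e, integral_sub (integrable_mul_cc (L1.integrable_coeFn c) g)
      (integrable_mul_cc (L1.integrable_coeFn c') g), hc g, hc' g, sub_self]
  rw [← sub_eq_zero]
  set d := c - c'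
  refine Lp.ext ((Integrable.ae_eq_zero_of_forall_setIntegral_eq_zero hd fun s hs hsf => ?_).trans
    (Lp.coeFn_zero _ _ _).symm)
  rw [← norm_le_zero_iff]
  refine le_of_forall_pos_le_add fun ε hε => ?_
  rw [zero_add]
  obtain ⟨δ, hδ, hlt⟩ := exists_pos_setLIntegral_lt_of_measure_lt
    (μ := lam) (f := fun z => ‖d z‖ₑ) hd.2.ne (ENNReal.ofReal_pos.2 hε).ne'
  obtain ⟨K, hKs, hK, hKl⟩ := hs.exists_isCompact_sdiff_lt hsf.ne (ENNReal.half_pos hδ.ne').ne'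
  obtain ⟨U, hsU, hU, -, hUl⟩ := hs.exists_isOpen_sdiff_lt hsf.ne (ENNReal.half_pos hδ.ne').ne'
  have hKm := hK.measurableSet
  have hUK : lam (U \ K) < δ := by
    rw [← ENNReal.add_halves δ]
    exact (measure_mono (fun x hx => (em (x ∈ s)).elim (fun h => Or.inr ⟨h, hx.2⟩)
      fun h => Or.inl ⟨hx.1, h⟩)).trans_lt
      ((measure_union_le _ _).trans_lt (ENNReal.add_lt_add hUl hKl))
  obtain ⟨χ, hχ1, hχ0, hχc, hχ⟩ := exists_continuous_one_zero_of_isCompact hK hU.isClosed_compl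
        (disjoint_compl_right_iff_subset.2 (hKs.trans hsU))
  let g : C_c(H, ℂ) := (⟨χ, hχc⟩ : C_c(H, ℝ)).compLeft ⟨fun r : ℝ => (r : ℂ), by fun_prop⟩
  have hg : ∀ z, g z = (χ z : ℂ) := fun z => by
    simp [g, CompactlySupportedContinuousMap.compLeft_apply]
  rw [← sub_zero (∫ z in s, d z ∂lam), ← hz g, ← integral_indicator hs,
    ← integral_sub (hd.indicator hs) (integrable_mul_cc hd g)]
  have hi : Integrable ((U \ K).indicator fun z => ‖d z‖) lam :=
    hd.norm.indicator (hU.measurableSet.diff hKm)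
  refine (norm_integral_le_of_norm_le hi (Eventually.of_forall fun z => ?_)).trans ?_
  · rw [hg]
    have h01 := hχ z
    by_cases hzK : z ∈ K
    · have : χ z = 1 := hχ1 hzK
      simp [hzK, hKs hzK, this]
    by_cases hzU : z ∈ U
    · rw [indicator_of_mem (show z ∈ U \ K from ⟨hzU, hzK⟩)]
      by_cases hzs : z ∈ s
      · have e : s.indicator d z - d z * (χ z : ℂ) = d z * ((1 - χ z : ℝ) : ℂ) := by
          rw [indicator_of_mem hzs]; push_cast; ring
        rw [e, norm_mul, Complex.norm_real, Real.norm_eq_abs, abs_of_nonneg (by linarith [h01.2])]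
        exact mul_le_of_le_one_right (norm_nonneg _) (by linarith [h01.1])
      · rw [indicator_of_notMem hzs, zero_sub, norm_neg, norm_mul, Complex.norm_real,
          Real.norm_eq_abs, abs_of_nonneg h01.1]
        exact mul_le_of_le_one_right (norm_nonneg _) h01.2
    · have : χ z = 0 := hχ0 hzU
      simp [hzU, this, show z ∉ s from fun h => hzU (hsU h)]
  · rw [integral_indicator (hU.measurableSet.diff hKm),
      integral_norm_eq_lintegral_enorm hd.1.restrict]
    exact ENNReal.toReal_le_of_le_ofReal hε.le (hlt _ hUK).le

end Convolution

/-- The convolution `a * b` of `L¹(H)`. -/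
noncomputable def l1Conv {lam : Measure H} (h : IsLeftHaar lam) (a b : Lp ℂ 1 lam) : Lp ℂ 1 lam :=
  (exists_isL1Conv h a b).choose

theorem isL1Conv_l1Conv {lam : Measure H} (h : IsLeftHaar lam) (a b : Lp ℂ 1 lam) :
    IsL1Conv lam a b (l1Conv h a b) :=
  (exists_isL1Conv h a b).choose_spec

/-! ### Weak almost periodicity -/

/-- A subset of a normed space `E` is relatively weakly compact if its closure in the weak topology
`σ(E, E*)` is weakly compact. -/
def IsRelWeaklyCompact {E : Type*} [NormedAddCommGroup E] [NormedSpace ℂ E] (S : Set E) : Prop :=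
  IsCompact (closure (toWeakSpace ℂ E '' S))

variable (H) in
/-- `wap(H)`: the `f ∈ C_b(H)` whose left orbit `{ℓ_x f : x ∈ H}` is relatively weakly compact in
`C_b(H)`. -/
def wap : Set (H →ᵇ ℂ) :=
  {f | IsRelWeaklyCompact (Set.range fun x : H => leftTranslate x f)}

/-- The orbit `{a · φ : a ∈ L¹(H), ‖a‖ ≤ 1}` of a functional `φ ∈ L^∞(H) = L¹(H)*`, where
`⟨a · φ, b⟩ = ⟨φ, a * b⟩`. For `φ` given by a function `f`, `a · φ` is given by the function
`t ↦ ∫ a(y) f(y * t) dlam(y)`, which is `(Δ⁻¹ ǎ) * f`. -/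
def l1Orbit {lam : Measure H} (h : IsLeftHaar lam) (φ : StrongDual ℂ (Lp ℂ 1 lam)) :
    Set (StrongDual ℂ (Lp ℂ 1 lam)) :=
  {ψ | ∃ a : Lp ℂ 1 lam, ‖a‖ ≤ 1 ∧ ∀ b, ψ b = φ (l1Conv h a b)}

/-- `WAP(L¹(H))`: the weakly almost periodic functionals on `L¹(H)`. -/
def WAP {lam : Measure H} (h : IsLeftHaar lam) : Set (StrongDual ℂ (Lp ℂ 1 lam)) :=
  {φ | IsRelWeaklyCompact (l1Orbit h φ)}

/-- The canonical map `C_b(H) → L^∞(H) = L¹(H)*`, `f ↦ (b ↦ ∫ f b dlam)`. -/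
noncomputable def toL1Dual (lam : Measure H) (f : H →ᵇ ℂ) : StrongDual ℂ (Lp ℂ 1 lam) :=
  LinearMap.mkContinuous
    { toFun := fun b => ∫ t, b t * f t ∂lam
      map_add' := fun b b' => by
        rw [← integral_add
          (integrable_mul_of_bounded (L1.integrable_coeFn b) f.continuous f.norm_coe_le_norm)
          (integrable_mul_of_bounded (L1.integrable_coeFn b') f.continuous f.norm_coe_le_norm)]
        refine integral_congr_ae ?_
        filter_upwards [Lp.coeFn_add b b'] with t ht
        rw [ht, Pi.add_apply, add_mul]
      map_smul' := fun r b => by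
        rw [RingHom.id_apply, smul_eq_mul, ← integral_const_mul]
        refine integral_congr_ae ?_
        filter_upwards [Lp.coeFn_smul r b] with t ht
        rw [ht, Pi.smul_apply, smul_eq_mul, mul_assoc] }
    ‖f‖
    (fun b => by
      rw [L1.norm_eq_integral_norm]
      exact norm_integral_mul_le (L1.integrable_coeFn b) f.norm_coe_le_norm)

end LCHypergroup

/-!
Write `φ_f = toL1Dual lam f` for the functional given by `f ∈ C_b(H)`, and `a · φ = φ(a * ·)`. The
map `f ↦ φ_f` is isometric, since `φ_f` recovers the value `f x` in the limit of the bump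
functions of mass one that concentrate at `x` (`tendsto_toL1Dual_bump`, `norm_toL1Dual`). In
particular it is injective and has closed range.

*A weakly almost periodic function gives a weakly almost periodic functional*
(`toL1Dual_mem_WAP`). By Fubini, `a · φ_f` is the weak integral `∫ a(x) φ_{ℓ_x f} dlam(x)`. The
map `x ↦ φ_{ℓ_x f}` is weak*-continuous with relatively weakly compact range, hence weakly
continuous, and by Krein's theorem the averages of such a map have weak limits along ultrafilters
(`exists_tendsto_average_complex`). Krein's theorem is proved here through Grothendieck's theorem
on separately continuous functions (`continuous_integral_of_separately_continuous`) and the fact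
that a functional on the dual of a Banach space that is weak*-continuous on the unit ball is an
evaluation.

*A weakly almost periodic functional `φ` comes from a function* (`exists_eq_toL1Dual_of_mem_WAP`).
For `b ∈ C_c(H)` the functional `a ↦ φ(a * b)` is given by the bounded continuous function
`x ↦ φ(δ_x * b)` (`apply_l1Conv_ccToL1`). Suppose that `φ` is not in the range of `C_b(H)`, and let `ξ`
in the bidual of `L¹(H)`, of norm at most one, vanish on that range but not at `φ`. By Goldstine's
theorem `ξ` is a weak* limit of elements `a` of the unit ball of `L¹(H)`. Along these, `a · φ` has
a weak limit `ψ`, and `ψ(b) = lim φ(a * b) = 0` for `b ∈ C_c(H)`. A weak* limit `κ` of symmetric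
bump functions at `e`, which form an approximate identity, satisfies `κ(a · φ) = φ(a)`, whence
`0 = κ(ψ) = lim φ(a) = ξ(φ)`, a contradiction.

*The function is weakly almost periodic* (`mem_wap_of_toL1Dual_mem_WAP`). Bump functions at `x`
show that `φ_{ℓ_x f}` lies in the weak closure of the orbit of `φ_f`, and relative weak
compactness passes to the closed subspace `C_b(H)`.

The structure of the hypergroup enters mainly through two facts. One is reversibility of supports,
`z ∈ supp (x * y)` implies `y ∈ supp (x̌ * z)` (`mem_supp_invol_left`); it gives compactly
supported translates and shows that `lam` has full support. The other is the adjoint relation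
`∫ g(y) f(x * y) dlam(y) = ∫ f(s) g(x̌ * s) dlam(s)` (`integral_mul_evalConv_comm`), which follows
from associativity and Fubini when `f` and `g` are smeared by a symmetric bump function, and in
general by approximation. It identifies `δ_x * b` with the translate `z ↦ b(x̌ * z)`.
-/

/-! ### Weak compactness in Banach spaces -/

section WeakCompactness

open Filter Set

variable {X : Type*} [NormedAddCommGroup X] [NormedSpace ℂ X]

theorem tendsto_toWeakSpace_iff {ι : Type*} {l : Filter ι} {u : ι → X} {x : X} :
    Tendsto (fun i => toWeakSpace ℂ X (u i)) l (𝓝 (toWeakSpace ℂ X x)) ↔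
      ∀ y : StrongDual ℂ X, Tendsto (fun i => y (u i)) l (𝓝 (y x)) := by
  rw [(NormedSpace.isEmbedding_inclusionInDoubleDualWeak ℂ X).tendsto_nhds_iff]
  exact tendsto_iff_forall_eval_tendsto_topDualPairing

/-- A relatively weakly compact set supports weak limits of ultrafilters. -/
theorem LCHypergroup.IsRelWeaklyCompact.exists_tendsto {S : Set X}
    (hS : LCHypergroup.IsRelWeaklyCompact S) {ι : Type*} (𝒰 : Ultrafilter ι) {u : ι → X}
    (hu : ∀ᶠ i in 𝒰, toWeakSpace ℂ X (u i) ∈ closure (toWeakSpace ℂ X '' S)) :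
    ∃ x, toWeakSpace ℂ X x ∈ closure (toWeakSpace ℂ X '' S) ∧
      ∀ y : StrongDual ℂ X, Tendsto (fun i => y (u i)) 𝒰 (𝓝 (y x)) := by
  obtain ⟨x, hx, hlim⟩ := isCompact_iff_ultrafilter_le_nhds.1 hS
    (𝒰.map fun i => toWeakSpace ℂ X (u i)) (le_principal_iff.2 hu)
  exact ⟨(toWeakSpace ℂ X).symm x, hx, tendsto_toWeakSpace_iff.1 hlim⟩

/-- A bounded set all of whose ultrafilters converge weakly is relatively weakly compact: its weak*
closure in the bidual is compact, and by assumption it consists of elements of `X`. -/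
theorem isRelWeaklyCompact_of_ultrafilter {S : Set X} (hb : Bornology.IsBounded S)
    (h : ∀ 𝒰 : Ultrafilter X, S ∈ 𝒰 →
      ∃ x, ∀ y : StrongDual ℂ X, Tendsto y 𝒰 (𝓝 (y x))) :
    LCHypergroup.IsRelWeaklyCompact S := by
  refine NormedSpace.isCompact_closure_of_isBounded ℂ X _ ?_ fun F hF => ?_
  · rwa [preimage_image_eq _ (toWeakSpace ℂ X).injective]
  · rw [image_image] at hF
    obtain ⟨𝒲, hS, hlim⟩ := mem_closure_iff_ultrafilter.1 hF
    obtain ⟨𝒰, hSU, hUW⟩ : ∃ 𝒰 : Ultrafilter X, S ∈ 𝒰 ∧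
        𝒰.map (fun x => NormedSpace.inclusionInDoubleDualWeak ℂ X (toWeakSpace ℂ X x)) = 𝒲 := by
      have hne : (comap (fun x => NormedSpace.inclusionInDoubleDualWeak ℂ X (toWeakSpace ℂ X x))
          (𝒲 : Filter _) ⊓ 𝓟 S).NeBot := comap_inf_principal_neBot_of_image_mem 𝒲.neBot hS
      have hle := Ultrafilter.of_le (comap (fun x => NormedSpace.inclusionInDoubleDualWeak ℂ X
        (toWeakSpace ℂ X x)) (𝒲 : Filter _) ⊓ 𝓟 S)
      exact ⟨_, le_principal_iff.1 (hle.trans inf_le_right),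
        Ultrafilter.coe_le_coe.1 (map_le_iff_le_comap.2 (hle.trans inf_le_left))⟩
    obtain ⟨x, hx⟩ := h 𝒰 hSU
    refine ⟨toWeakSpace ℂ X x, ?_⟩
    have h1 : Tendsto (fun x => NormedSpace.inclusionInDoubleDualWeak ℂ X (toWeakSpace ℂ X x)) 𝒰
        (𝓝 F) := by
      rw [← hUW] at hlim; exact hlim
    refine tendsto_nhds_unique ?_ h1
    exact tendsto_iff_forall_eval_tendsto_topDualPairing.2 hx

/-- **Goldstine's theorem**: the unit ball of `X` is weak*-dense in the unit ball of `X**`. -/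
theorem exists_ultrafilter_tendsto_bidual (ξ : StrongDual ℂ (StrongDual ℂ X)) (hξ : ‖ξ‖ ≤ 1) :
    ∃ 𝒰 : Ultrafilter X, Metric.closedBall 0 1 ∈ 𝒰 ∧
      ∀ g : StrongDual ℂ X, Tendsto g 𝒰 (𝓝 (ξ g)) := by
  classical
  -- finitely many functionals at a time
  have key : ∀ (s : Finset (StrongDual ℂ X)),
      (fun g : s => ξ g) ∈ closure ((fun x : X => fun g : s => (g : StrongDual ℂ X) x) ''
        Metric.closedBall 0 1) := by
    intro s
    by_contra hmem
    have hconv : Convex ℝ ((fun x : X => fun g : s => (g : StrongDual ℂ X) x) ''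
        Metric.closedBall 0 1) :=
      (convex_closedBall (0 : X) 1).is_linear_image
        ⟨fun x y => by ext; simp, fun c x => by ext; simp⟩
    obtain ⟨f, u, hlt, hu⟩ := RCLike.geometric_hahn_banach_closed_point (𝕜 := ℂ) hconv.closure
      isClosed_closure hmem
    -- the separating functional of the finite-dimensional space is a combination of coordinates
    have hf : ∀ v : s → ℂ, f v = ∑ g : s, v g * f (Pi.single g 1) := fun v => by
      conv_lhs => rw [← Finset.univ_sum_single v]
      rw [map_sum]
      refine Finset.sum_congr rfl fun g _ => ?_
      rw [← smul_eq_mul, ← map_smul, ← Pi.single_smul, smul_eq_mul, mul_one]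
    set G : StrongDual ℂ X := ∑ g : s, f (Pi.single g 1) • (g : StrongDual ℂ X) with hG
    have hGx : ∀ x, f (fun g : s => (g : StrongDual ℂ X) x) = G x := fun x => by
      rw [hf, hG]; simp [mul_comm]
    have hGξ : f (fun g : s => ξ g) = ξ G := by
      rw [hf, hG]; simp [mul_comm]
    have hle : ‖G‖ ≤ u := by
      have hu0 : 0 ≤ u := by
        have := hlt _ (subset_closure ⟨0, by simp, rfl⟩)
        rw [hGx] at this
        simpa using this.le
      refine ContinuousLinearMap.opNorm_le_of_unit_norm (𝕜 := ℂ) hu0 fun x hx => ?_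
      by_cases h0 : G x = 0
      · simpa [h0] using hu0
      have hc : ‖(starRingEnd ℂ (G x)) / ‖G x‖‖ = 1 := by
        simp [h0]
      have := hlt _ (subset_closure ⟨((starRingEnd ℂ (G x)) / ‖G x‖) • x, by
        simp only [Metric.mem_closedBall, dist_zero_right]
        rw [norm_smul, hc, hx, one_mul], rfl⟩)
      rw [hGx, map_smul, smul_eq_mul] at this
      have e : (starRingEnd ℂ (G x)) / ‖G x‖ * G x = (‖G x‖ : ℂ) := by
        have : (‖G x‖ : ℂ) ≠ 0 := by exact_mod_cast norm_ne_zero_iff.2 h0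
        rw [div_mul_eq_mul_div, div_eq_iff this, mul_comm, Complex.mul_conj, Complex.normSq_eq_norm_sq]
        push_cast; ring
      rw [e] at this
      simpa using this.le
    rw [hGξ] at hu
    have : RCLike.re (ξ G) ≤ ‖ξ‖ * ‖G‖ := (RCLike.re_le_norm _).trans (ξ.le_opNorm G)
    have : ‖ξ‖ * ‖G‖ ≤ 1 * ‖G‖ := by gcongr
    linarith
  have hne : ((⨅ g : StrongDual ℂ X, comap g (𝓝 (ξ g))) ⊓
      𝓟 (Metric.closedBall (0 : X) 1)).NeBot := by
    rw [inf_principal_neBot_iff]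
    intro U hU
    rw [mem_iInf] at hU
    obtain ⟨I, hI, V, hV, rfl⟩ := hU
    have := hI.to_subtype
    choose W hW hWV using fun i => mem_comap.1 (hV i)
    obtain ⟨v, hv, x, hx, rfl⟩ := mem_closure_iff_nhds.1 (key hI.toFinset)
      (Set.univ.pi fun g => W ⟨g.1, hI.mem_toFinset.1 g.2⟩)
      (set_pi_mem_nhds finite_univ fun g _ => hW ⟨g.1, hI.mem_toFinset.1 g.2⟩)
    exact ⟨x, mem_iInter.2 fun i => hWV i (hv ⟨i.1, hI.mem_toFinset.2 i.2⟩ trivial), hx⟩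
  have hle := Ultrafilter.of_le ((⨅ g : StrongDual ℂ X, comap g (𝓝 (ξ g))) ⊓
    𝓟 (Metric.closedBall (0 : X) 1))
  exact ⟨_, le_principal_iff.1 (hle.trans inf_le_right), fun g =>
    tendsto_comap.mono_left (hle.trans (inf_le_left.trans (iInf_le _ g)))⟩

theorem mem_of_forall_exists_norm_sub_le {Y : Type*} [NormedAddCommGroup Y] {S : Set Y}
    (hS : IsClosed S) {x : Y}
    (h : ∀ ε > 0, ∃ s ∈ S, ‖x - s‖ ≤ ε) : x ∈ S := by
  rw [← hS.closure_eq]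
  refine Metric.mem_closure_iff.2 fun ε hε => ?_
  obtain ⟨s, hs, hle⟩ := h (ε / 2) (by positivity)
  exact ⟨s, hs, by rw [dist_eq_norm]; linarith⟩

/-- A functional which is at most `ε` on the part of the unit ball annihilated by finitely many
functionals is within `ε` of their span. -/
theorem exists_norm_sub_sum_smul_le {ι : Type*} [Fintype ι] (F : StrongDual ℂ X)
    (L : ι → StrongDual ℂ X) {ε : ℝ} (hε : 0 ≤ ε)
    (h : ∀ y, ‖y‖ ≤ 1 → (∀ i, L i y = 0) → ‖F y‖ ≤ ε) :
    ∃ c : ι → ℂ, ‖F - ∑ i, c i • L i‖ ≤ ε := by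
  set p : Subspace ℂ X := ⨅ i, LinearMap.ker (L i).toLinearMap with hp
  have hpx : ∀ y ∈ p, ∀ i, L i y = 0 := fun y hy i => by
    simpa using (Submodule.mem_iInf _).1 hy i
  have hFp : ‖F.comp p.subtypeL‖ ≤ ε :=
    ContinuousLinearMap.opNorm_le_of_unit_norm (𝕜 := ℂ) hε fun y hy =>
      h y (le_of_eq hy) (hpx y y.2)
  obtain ⟨G, hG, hGn⟩ := exists_extension_norm_eq p (F.comp p.subtypeL)
  have hspan : (F - G).toLinearMap ∈
      Submodule.span ℂ (range fun i => (L i).toLinearMap) := by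
    refine mem_span_of_iInf_ker_le_ker fun y hy => ?_
    have := hG ⟨y, hy⟩
    simp only [LinearMap.mem_ker, ContinuousLinearMap.coe_coe, sub_apply]
    rw [sub_eq_zero, this]
    rfl
  obtain ⟨c, hc⟩ := (Submodule.mem_span_range_iff_exists_fun ℂ).1 hspan
  refine ⟨c, ?_⟩
  have : ∑ i, c i • L i = F - G := by
    ext y
    simpa using LinearMap.congr_fun hc y
  rw [this, sub_sub_cancel, hGn]
  exact hFp

/-- A functional on the dual of a Banach space that is weak*-continuous at `0` on the unit ball is
the evaluation at a vector. By Hahn-Banach it is within `ε` of the (norm-closed) space of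
evaluations, for every `ε`. -/
theorem exists_eq_eval_of_weakStar_continuous [CompleteSpace X]
    (F : StrongDual ℂ (StrongDual ℂ X))
    (hF : ∀ u : Finset X → StrongDual ℂ X, (∀ s, ‖u s‖ ≤ 1) →
      (∀ x, Tendsto (fun s => u s x) atTop (𝓝 0)) → Tendsto (fun s => F (u s)) atTop (𝓝 0)) :
    ∃ x, ∀ y : StrongDual ℂ X, F y = y x := by
  have hF' : ∀ ε > 0, ∃ s : Finset X, ∀ y : StrongDual ℂ X, ‖y‖ ≤ 1 →
      (∀ x ∈ s, y x = 0) → ‖F y‖ ≤ ε := by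
    intro ε hε
    by_contra! hcon
    choose u hu1 hu0 hu using hcon
    have := hF u hu1 fun x => tendsto_const_nhds.congr' <| by
      filter_upwards [eventually_ge_atTop {x}] with s hs
      exact (hu0 s x (Finset.singleton_subset_iff.1 hs)).symm
    obtain ⟨s, hs⟩ := (this.norm.eventually (gt_mem_nhds (by simpa using hε))).exists
    exact absurd hs (hu s).not_gt
  set J := NormedSpace.inclusionInDoubleDualLi (E := X) ℂ
  have hcl : IsClosed (range J) := J.isometry.isUniformInducing.isComplete_range.isClosed
  suffices h : F ∈ range J by
    obtain ⟨x, hx⟩ := h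
    exact ⟨x, fun y => by rw [← hx]; rfl⟩
  refine mem_of_forall_exists_norm_sub_le hcl fun ε hε => ?_
  obtain ⟨s, hs⟩ := hF' ε hε
  obtain ⟨c, hc⟩ := exists_norm_sub_sum_smul_le F
    (fun x : s => NormedSpace.inclusionInDoubleDual ℂ X x) hε.le
    fun y hy h0 => hs y hy fun x hx => h0 ⟨x, hx⟩
  refine ⟨_, ⟨∑ x, c x • (x : X), rfl⟩, ?_⟩
  have e : J (∑ x, c x • (x : X)) =
      ∑ x, c x • NormedSpace.inclusionInDoubleDual ℂ X (x : X) := by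
    ext y
    change y (∑ x, c x • (x : X)) = _
    simp [map_sum]
  rw [e]
  exact hc

/-- Grothendieck's theorem on separate continuity: on a product of two compact spaces, the integral
of a bounded separately continuous function over one variable is continuous in the other. If it were
not, there would be a sequence along which the integrals stay away from the limit, but which can be
chosen to converge pointwise on a set that is dense enough for the sequence itself; compactness then
gives pointwise convergence everywhere, against dominated convergence. -/
theorem continuous_integral_of_separately_continuous {Z K : Type*} [TopologicalSpace Z]
    [CompactSpace Z] [TopologicalSpace K] [CompactSpace K] [MeasurableSpace K] [BorelSpace K]
    (μ : Measure K) [IsFiniteMeasure μ] {Φ : Z → K → ℂ} (h1 : ∀ k, Continuous fun z => Φ z k)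
    (h2 : ∀ z, Continuous (Φ z)) {M : ℝ} (hM : ∀ z k, ‖Φ z k‖ ≤ M) :
    Continuous fun z => ∫ k, Φ z k ∂μ := by
  classical
  refine continuous_iff_continuousAt.2 fun z₀ => ?_
  by_contra hcon
  obtain ⟨ε, hε, hfreq⟩ : ∃ ε > 0, ∃ᶠ z in 𝓝 z₀,
      ε ≤ dist (∫ k, Φ z k ∂μ) (∫ k, Φ z₀ k ∂μ) := by
    rw [ContinuousAt, Metric.tendsto_nhds] at hcon
    push Not at hcon
    simpa using hcon
  have hζ : ∀ (D : Finset K) (n : ℕ), ∃ z, (∀ k ∈ D, dist (Φ z k) (Φ z₀ k) < 1 / ((n : ℝ) + 1)) ∧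
      ε ≤ dist (∫ k, Φ z k ∂μ) (∫ k, Φ z₀ k ∂μ) := by
    intro D n
    have : ∀ᶠ z in 𝓝 z₀, ∀ k ∈ D, dist (Φ z k) (Φ z₀ k) < 1 / ((n : ℝ) + 1) :=
      (Filter.eventually_all_finset D).2 fun k _ =>
        Metric.tendsto_nhds.1 ((h1 k).tendsto z₀) _ (by positivity)
    exact (hfreq.and_eventually this).exists.imp fun z hz => hz.symm
  choose ζ hζ1 hζ2 using hζ
  have hnet : ∀ (s : Finset Z) (n : ℕ), ∃ D : Finset K, ∀ k, ∃ k' ∈ D, ∀ z ∈ s,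
      dist (Φ z k) (Φ z k') < 1 / ((n : ℝ) + 1) := by
    intro s n
    obtain ⟨D, -, hD⟩ := isCompact_univ.elim_nhds_subcover
      (fun k' : K => {k | ∀ z ∈ s, dist (Φ z k) (Φ z k') < 1 / ((n : ℝ) + 1)})
      (fun k' _ => (Filter.eventually_all_finset s).2 fun z _ =>
        Metric.tendsto_nhds.1 ((h2 z).tendsto k') _ (by positivity))
    refine ⟨D, fun k => ?_⟩
    obtain ⟨k', hk', h⟩ := mem_iUnion₂.1 (hD (mem_univ k))
    exact ⟨k', hk', h⟩
  choose net hnet using hnet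
  -- the points of `Z` and of `K` chosen so far
  let st : ℕ → Finset Z × Finset K := fun n => Nat.rec ({z₀}, ∅) (fun n p =>
    (insert (ζ p.2 n) p.1, p.2 ∪ net (insert (ζ p.2 n) p.1) n)) n
  let zs : ℕ → Z := fun n => ζ (st n).2 n
  have st1 : ∀ n, (st (n + 1)).1 = insert (zs n) (st n).1 := fun n => rfl
  have st2 : ∀ n, (st (n + 1)).2 = (st n).2 ∪ net (st (n + 1)).1 n := fun n => rfl
  have mono1 : Monotone fun n => (st n).1 := monotone_nat_of_le_succ fun n => by
    simp only [st1]; exact Finset.subset_insert _ _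
  have mono2 : Monotone fun n => (st n).2 := monotone_nat_of_le_succ fun n => by
    simp only [st2]; exact Finset.subset_union_left
  have hz₀ : ∀ n, z₀ ∈ (st n).1 := fun n => mono1 (Nat.zero_le n) (by simp [st])
  have hzs : ∀ i n, i ≤ n → zs i ∈ (st (n + 1)).1 := fun i n hin =>
    mono1 (Nat.succ_le_succ hin) (by simp only [st1]; exact Finset.mem_insert_self _ _)
  have hlim0 : Tendsto (fun n : ℕ => 1 / ((n : ℝ) + 1)) atTop (𝓝 0) :=
    tendsto_one_div_add_atTop_nhds_zero_nat
  have hD : ∀ m, ∀ k ∈ (st m).2, Tendsto (fun n => Φ (zs n) k) atTop (𝓝 (Φ z₀ k)) := by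
    intro m k hk
    rw [tendsto_iff_dist_tendsto_zero]
    refine squeeze_zero' (Eventually.of_forall fun _ => dist_nonneg) ?_ hlim0
    filter_upwards [eventually_ge_atTop m] with n hn
    exact (hζ1 _ n k (mono2 hn hk)).le
  have hpt : ∀ k, Tendsto (fun n => Φ (zs n) k) atTop (𝓝 (Φ z₀ k)) := by
    intro k
    rw [tendsto_iff_ultrafilter]
    intro 𝒲 h𝒲
    choose kk hkk hdist using fun n => hnet (st (n + 1)).1 n k
    have hkk' : ∀ n, kk n ∈ (st (n + 1)).2 := fun n => by
      rw [st2]; exact Finset.mem_union_right _ (hkk n)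
    obtain ⟨k', -, hk'⟩ := isCompact_univ.ultrafilter_le_nhds (𝒲.map kk) (by simp)
    obtain ⟨z', -, hz'⟩ := isCompact_univ.ultrafilter_le_nhds (𝒲.map zs) (by simp)
    have hk'' : Tendsto kk 𝒲 (𝓝 k') := hk'
    have hz'' : Tendsto zs 𝒲 (𝓝 z') := hz'
    have eq1 : ∀ z, (∀ᶠ n in atTop, z ∈ (st (n + 1)).1) → Φ z k' = Φ z k := by
      intro z hz
      refine tendsto_nhds_unique (((h2 z).tendsto k').comp hk'') ?_
      rw [tendsto_iff_dist_tendsto_zero]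
      refine squeeze_zero' (Eventually.of_forall fun _ => dist_nonneg) (h𝒲 ?_)
        (hlim0.mono_left h𝒲)
      filter_upwards [hz] with n hn
      rw [dist_comm]
      exact (hdist n z hn).le
    have eq2 : Φ z' k' = Φ z' k := by
      refine tendsto_nhds_unique (((h1 k').tendsto z').comp hz'') ?_
      refine (((h1 k).tendsto z').comp hz'').congr fun i => ?_
      exact (eq1 (zs i) (by filter_upwards [eventually_ge_atTop i] with n hn using hzs i n hn)).symm
    have eq3 : ∀ n, Φ z' (kk n) = Φ z₀ (kk n) := fun n =>
      tendsto_nhds_unique (((h1 (kk n)).tendsto z').comp hz'')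
        ((hD (n + 1) _ (hkk' n)).mono_left h𝒲)
    have eq4 : Φ z' k' = Φ z₀ k' :=
      tendsto_nhds_unique (((h2 z').tendsto k').comp hk'')
        ((((h2 z₀).tendsto k').comp hk'').congr fun n => (eq3 n).symm)
    rw [← eq1 z₀ (Eventually.of_forall fun n => hz₀ (n + 1)), ← eq4, eq2]
    exact ((h1 k).tendsto z').comp hz''
  have hconv : Tendsto (fun n => ∫ k, Φ (zs n) k ∂μ) atTop (𝓝 (∫ k, Φ z₀ k ∂μ)) :=
    tendsto_integral_of_dominated_convergence (fun _ => M)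
      (fun n => (h2 _).aestronglyMeasurable) (integrable_const M)
      (fun n => Eventually.of_forall fun k => hM _ k) (Eventually.of_forall hpt)
  obtain ⟨n, hn⟩ := (Metric.tendsto_nhds.1 hconv ε hε).exists
  exact absurd hn (hζ2 _ n).not_gt

/-- **Krein's theorem**, in the form of the existence of barycenters: a weakly continuous bounded
map from a compact space to a Banach space has a weak integral against every finite measure. -/
theorem exists_barycenter [CompleteSpace X] {K : Type*} [TopologicalSpace K] [CompactSpace K]
    [MeasurableSpace K] [BorelSpace K] (μ : Measure K) [IsFiniteMeasure μ] {A : K → X}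
    (hA : ∀ y : StrongDual ℂ X, Continuous fun k => y (A k)) {C : ℝ} (hC : ∀ k, ‖A k‖ ≤ C) :
    ∃ x, ∀ y : StrongDual ℂ X, y x = ∫ k, y (A k) ∂μ := by
  have hle : ∀ (y : StrongDual ℂ X) k, ‖y (A k)‖ ≤ ‖y‖ * C := fun y k =>
    (y.le_opNorm _).trans (by gcongr; exact hC k)
  have hi : ∀ y : StrongDual ℂ X, Integrable (fun k => y (A k)) μ := fun y =>
    Integrable.of_bound (hA y).aestronglyMeasurable _ (Eventually.of_forall (hle y))
  let F : StrongDual ℂ (StrongDual ℂ X) := LinearMap.mkContinuous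
    { toFun := fun y => ∫ k, y (A k) ∂μ
      map_add' := fun y z => integral_add (hi y) (hi z)
      map_smul' := fun c y => integral_const_mul c _ } (C * μ.real univ) fun y => by
        refine (norm_integral_le_of_norm_le_const (Eventually.of_forall (hle y))).trans (le_of_eq ?_)
        ring
  have hFy : ∀ y, F y = ∫ k, y (A k) ∂μ := fun y => rfl
  obtain ⟨x, hx⟩ := exists_eq_eval_of_weakStar_continuous F fun u hu hu0 => by
    let Z : Set (WeakDual ℂ X) := WeakDual.toStrongDual ⁻¹' Metric.closedBall 0 1
    have : CompactSpace Z := isCompact_iff_compactSpace.1 (WeakDual.isCompact_closedBall 0 1)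
    have hcont := continuous_integral_of_separately_continuous μ (Z := Z)
      (Φ := fun z k => (z : WeakDual ℂ X) (A k)) (M := |C|)
      (fun k => (WeakDual.eval_continuous (A k)).comp continuous_subtype_val)
      (fun z => hA (WeakDual.toStrongDual z.1)) (fun z k => by
        have hz : ‖WeakDual.toStrongDual z.1‖ ≤ 1 := mem_closedBall_zero_iff.1 z.2
        refine (hle (WeakDual.toStrongDual z.1) k).trans ?_
        calc _ ≤ ‖WeakDual.toStrongDual z.1‖ * |C| := by gcongr; exact le_abs_self C
          _ ≤ 1 * |C| := by gcongr
          _ = |C| := one_mul _)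
    let v : Finset X → Z := fun s => ⟨StrongDual.toWeakDual (u s), mem_closedBall_zero_iff.2 (hu s)⟩
    let z₀ : Z := ⟨0, by simp [Z]⟩
    have hv : Tendsto v atTop (𝓝 z₀) := by
      rw [tendsto_subtype_rng]
      exact tendsto_iff_forall_eval_tendsto_topDualPairing.2 hu0
    have h0 : ∫ k, (z₀ : WeakDual ℂ X) (A k) ∂μ = 0 := integral_zero _ _
    have := (hcont.tendsto z₀).comp hv
    rwa [h0] at this
  exact ⟨x, fun y => (hx y).symm⟩

/-- The averages `∫ a(h) A(h) dλ(h)` of a weakly continuous map with relatively weakly compact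
range, over the densities `a ≥ 0` of mass at most one, have weak limits along ultrafilters. The limit is
the barycenter of the measure on the weak closure of the range that represents the limit functional
`g ↦ lim ∫ a(h) g(A(h)) dλ(h)`. -/
theorem exists_tendsto_average [CompleteSpace X] {H : Type*} [TopologicalSpace H]
    [MeasurableSpace H] [OpensMeasurableSpace H] {lam : Measure H} {A : H → X}
    (hA : ∀ y : StrongDual ℂ X, Continuous fun h => y (A h)) {C : ℝ} (hC : ∀ h, ‖A h‖ ≤ C)
    (hrel : LCHypergroup.IsRelWeaklyCompact (range A)) {ι : Type*} (𝒰 : Ultrafilter ι)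
    {a : ι → H → ℝ} (ha : ∀ i, Integrable (a i) lam) (ha0 : ∀ i h, 0 ≤ a i h)
    (ha1 : ∀ᶠ i in 𝒰, ∫ h, a i h ∂lam ≤ 1) :
    ∃ x, ∀ y : StrongDual ℂ X,
      Tendsto (fun i => ∫ h, (a i h : ℂ) * y (A h) ∂lam) 𝒰 (𝓝 (y x)) := by
  have : T2Space (WeakSpace ℂ X) :=
    (NormedSpace.isEmbedding_inclusionInDoubleDualWeak ℂ X).t2Space
  set K : Set (WeakSpace ℂ X) := closure (toWeakSpace ℂ X '' range A) with hK
  have : CompactSpace K := isCompact_iff_compactSpace.1 hrel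
  let _ : MeasurableSpace K := borel K
  have : BorelSpace K := ⟨rfl⟩
  have hKC : ∀ k : K, ‖(toWeakSpace ℂ X).symm k‖ ≤ C := by
    intro k
    have hcl : IsClosed (toWeakSpace ℂ X '' Metric.closedBall (0 : X) C) := by
      rw [← Metric.isClosed_closedBall.closure_eq,
        (convex_closedBall (0 : X) C).toWeakSpace_closure ℂ]
      exact isClosed_closure
    obtain ⟨x, hx, hxk⟩ := closure_minimal (image_mono (range_subset_iff.2 fun h =>
      mem_closedBall_zero_iff.2 (hC h))) hcl k.2
    rw [← hxk, LinearEquiv.symm_apply_apply]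
    exact mem_closedBall_zero_iff.1 hx
  have hKy : ∀ y : StrongDual ℂ X, Continuous fun k : K => y ((toWeakSpace ℂ X).symm k) := fun y =>
    continuous_iff_continuousAt.2 fun k => by
      refine tendsto_toWeakSpace_iff.1 ?_ y
      simp only [LinearEquiv.apply_symm_apply]
      exact continuous_subtype_val.tendsto k
  let α : H → K := fun h => ⟨toWeakSpace ℂ X (A h), subset_closure ⟨_, ⟨h, rfl⟩, rfl⟩⟩
  have hα : Continuous α := continuous_iff_continuousAt.2 fun h =>
    tendsto_subtype_rng.2 (tendsto_toWeakSpace_iff.2 fun y => (hA y).tendsto h)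
  have hi : ∀ i (g : C_c(K, ℝ)), Integrable (fun h => a i h * g (α h)) lam := fun i g => by
    obtain ⟨M, hM⟩ := g.continuous.bounded_above_of_compact_support g.hasCompactSupport
    exact (ha i).mul_bdd (c := M) (g.continuous.comp hα).aestronglyMeasurable
      (Eventually.of_forall fun h => hM _)
  have hlim : ∀ g : C_c(K, ℝ), ∃ r, Tendsto (fun i => ∫ h, a i h * g (α h) ∂lam) 𝒰 (𝓝 r) := by
    intro g
    obtain ⟨M, hM⟩ := g.continuous.bounded_above_of_compact_support g.hasCompactSupport
    obtain ⟨r, -, hr⟩ := (isCompact_closedBall (0 : ℝ) |M|).ultrafilter_le_nhds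
      (𝒰.map fun i => ∫ h, a i h * g (α h) ∂lam) (tendsto_principal.2 (by
        filter_upwards [ha1] with i hi1
        refine mem_closedBall_zero_iff.2 ?_
        calc ‖∫ h, a i h * g (α h) ∂lam‖ ≤ ∫ h, a i h * |M| ∂lam :=
              norm_integral_le_of_norm_le ((ha i).mul_const _) (Eventually.of_forall fun h => by
                rw [norm_mul, Real.norm_of_nonneg (ha0 i h)]
                exact mul_le_mul_of_nonneg_left ((hM _).trans (le_abs_self M)) (ha0 i h))
          _ = (∫ h, a i h ∂lam) * |M| := integral_mul_const _ _
          _ ≤ 1 * |M| := by gcongr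
          _ = |M| := one_mul _))
    exact ⟨r, hr⟩
  choose Λ hΛ using hlim
  let Λ' : C_c(K, ℝ) →ₚ[ℝ] ℝ := PositiveLinearMap.mk₀
    { toFun := Λ
      map_add' := fun f g => tendsto_nhds_unique (hΛ (f + g)) (((hΛ f).add (hΛ g)).congr fun i => by
        rw [← integral_add (hi i f) (hi i g)]
        simp [mul_add])
      map_smul' := fun c f => tendsto_nhds_unique (hΛ (c • f)) (((hΛ f).const_mul c).congr
        fun i => by
          rw [← integral_const_mul]
          simp [mul_left_comm]) }
    (fun f hf => ge_of_tendsto' (hΛ f) fun i => integral_nonneg fun h =>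
      mul_nonneg (ha0 i h) (hf (α h)))
  set μ := RealRMK.rieszMeasure Λ' with hμ
  have hμΛ : ∀ g : C_c(K, ℝ), ∫ k, g k ∂μ = Λ g := RealRMK.integral_rieszMeasure Λ'
  have : IsFiniteMeasure μ := ⟨isCompact_univ.measure_lt_top⟩
  obtain ⟨x, hx⟩ := exists_barycenter μ (A := fun k : K => (toWeakSpace ℂ X).symm k) hKy hKC
  refine ⟨x, fun y => ?_⟩
  let u : C_c(K, ℝ) := ⟨⟨fun k => (y ((toWeakSpace ℂ X).symm k)).re,
    Complex.continuous_re.comp (hKy y)⟩, HasCompactSupport.of_compactSpace _⟩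
  let v : C_c(K, ℝ) := ⟨⟨fun k => (y ((toWeakSpace ℂ X).symm k)).im,
    Complex.continuous_im.comp (hKy y)⟩, HasCompactSupport.of_compactSpace _⟩
  have hint : Integrable (fun k : K => y ((toWeakSpace ℂ X).symm k)) μ :=
    Integrable.of_bound (hKy y).aestronglyMeasurable (‖y‖ * C) (Eventually.of_forall fun k =>
      (y.le_opNorm _).trans (by gcongr; exact hKC k))
  have hyx : y x = (Λ u : ℂ) + Complex.I * (Λ v : ℂ) := by
    rw [hx, ← hμΛ, ← hμΛ, ← integral_re_add_im hint, mul_comm Complex.I]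
    rfl
  rw [hyx]
  refine (((Complex.continuous_ofReal.tendsto _).comp (hΛ u)).add
    (((Complex.continuous_ofReal.tendsto _).comp (hΛ v)).const_mul Complex.I)).congr fun i => ?_
  simp only [Function.comp_apply]
  rw [← integral_complex_ofReal, ← integral_complex_ofReal, ← integral_const_mul,
    ← integral_add (hi i u).ofReal ((hi i v).ofReal.const_mul _)]
  refine integral_congr_ae (Eventually.of_forall fun h => ?_)
  have : y (A h) = (u (α h) : ℂ) + Complex.I * (v (α h) : ℂ) := by
    rw [mul_comm Complex.I]; exact (Complex.re_add_im _).symm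
  simp only [this]
  push_cast
  ring

variable {Y : Type*} [NormedAddCommGroup Y] [NormedSpace ℂ Y]

theorem LCHypergroup.IsRelWeaklyCompact.image {S : Set X}
    (hS : LCHypergroup.IsRelWeaklyCompact S) (T : X →L[ℂ] Y) :
    LCHypergroup.IsRelWeaklyCompact (T '' S) := by
  have : T2Space (WeakSpace ℂ Y) :=
    (NormedSpace.isEmbedding_inclusionInDoubleDualWeak ℂ Y).t2Space
  refine (IsCompact.image hS (WeakSpace.map T).continuous).closure_of_subset ?_
  rintro _ ⟨_, ⟨x, hx, rfl⟩, rfl⟩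
  exact ⟨toWeakSpace ℂ X x, subset_closure ⟨x, hx, rfl⟩, rfl⟩

theorem LCHypergroup.IsRelWeaklyCompact.of_mem_closure {S S' : Set X}
    (hS : LCHypergroup.IsRelWeaklyCompact S)
    (h : ∀ x ∈ S', toWeakSpace ℂ X x ∈ closure (toWeakSpace ℂ X '' S)) :
    LCHypergroup.IsRelWeaklyCompact S' :=
  IsCompact.of_isClosed_subset hS isClosed_closure
    (closure_minimal (image_subset_iff.2 h) isClosed_closure)

/-- Hahn-Banach separation of a point from a closed subspace, by a norming functional of the
quotient. -/
theorem exists_strongDual_eq_zero_of_notMem {p : Submodule ℂ X} (hp : IsClosed (p : Set X)) {x : X}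
    (hx : x ∉ p) : ∃ f : StrongDual ℂ X, ‖f‖ ≤ 1 ∧ (∀ y ∈ p, f y = 0) ∧ f x ≠ 0 := by
  have := hp
  obtain ⟨g, hg, hgx⟩ := exists_dual_vector'' ℂ (Submodule.Quotient.mk x : X ⧸ p)
  refine ⟨g.comp (LinearMap.mkContinuous p.mkQ 1 fun y => ?_), ?_, fun y hy => ?_, ?_⟩
  · rw [one_mul]; exact Submodule.Quotient.norm_mk_le p y
  · refine (ContinuousLinearMap.opNorm_comp_le _ _).trans ?_
    exact mul_le_one₀ hg (norm_nonneg _) (LinearMap.mkContinuous_norm_le _ zero_le_one _)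
  · change g (Submodule.Quotient.mk y) = 0
    rw [(Submodule.Quotient.mk_eq_zero p).2 hy, map_zero]
  · change g (Submodule.Quotient.mk x) ≠ 0
    rw [hgx]
    simpa using hx

/-- Relative weak compactness can be tested in a larger Banach space. -/
theorem isRelWeaklyCompact_of_image_linearIsometry [CompleteSpace X] {S : Set X}
    (hb : Bornology.IsBounded S) (T : X →ₗᵢ[ℂ] Y)
    (hS : LCHypergroup.IsRelWeaklyCompact (T '' S)) : LCHypergroup.IsRelWeaklyCompact S := by
  refine isRelWeaklyCompact_of_ultrafilter hb fun 𝒰 h𝒰 => ?_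
  obtain ⟨ψ, -, hψ⟩ := hS.exists_tendsto 𝒰 (u := T) (by
    filter_upwards [h𝒰] with x hx
    exact subset_closure ⟨_, ⟨x, hx, rfl⟩, rfl⟩)
  have hcl : IsClosed ((LinearMap.range T.toLinearMap : Submodule ℂ Y) : Set Y) :=
    T.isometry.isUniformInducing.isComplete_range.isClosed
  -- a closed subspace is weakly closed
  obtain ⟨x, rfl⟩ : ψ ∈ LinearMap.range T.toLinearMap := by
    by_contra hne
    obtain ⟨f, -, hf0, hf⟩ := exists_strongDual_eq_zero_of_notMem hcl hne
    refine hf (tendsto_nhds_unique (hψ f) (tendsto_const_nhds.congr fun x => ?_))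
    exact (hf0 _ ⟨x, rfl⟩).symm
  refine ⟨x, fun y => ?_⟩
  obtain ⟨z, hz, -⟩ := exists_extension_norm_eq (LinearMap.range T.toLinearMap)
    (y.comp (T.equivRange.symm.toContinuousLinearEquiv :
      LinearMap.range T.toLinearMap →L[ℂ] X))
  have hzT : ∀ x, z (T x) = y x := fun x => by
    refine (hz (T.equivRange x)).trans ?_
    exact congrArg y (T.equivRange.symm_apply_apply x)
  rw [← hzT x]
  exact (hψ z).congr hzT

/-- The averages `∫ a(h) A(h) dλ(h)` over complex densities of norm at most one have weak limits
along ultrafilters: split `a` into the positive and negative parts of its real and imaginary parts. -/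
theorem exists_tendsto_average_complex [CompleteSpace X] {H : Type*} [TopologicalSpace H]
    [MeasurableSpace H] [OpensMeasurableSpace H] {lam : Measure H} {A : H → X}
    (hA : ∀ y : StrongDual ℂ X, Continuous fun h => y (A h)) {C : ℝ} (hC : ∀ h, ‖A h‖ ≤ C)
    (hrel : LCHypergroup.IsRelWeaklyCompact (range A)) {ι : Type*} (𝒰 : Ultrafilter ι)
    {a : ι → H → ℂ} (ha : ∀ i, Integrable (a i) lam)
    (ha1 : ∀ᶠ i in 𝒰, ∫ h, ‖a i h‖ ∂lam ≤ 1) :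
    ∃ x, ∀ y : StrongDual ℂ X,
      Tendsto (fun i => ∫ h, a i h * y (A h) ∂lam) 𝒰 (𝓝 (y x)) := by
  have hpart : ∀ r : ι → H → ℝ, (∀ i, Integrable (r i) lam) → (∀ i h, r i h ≤ ‖a i h‖) →
      ∃ x, ∀ y : StrongDual ℂ X, Tendsto
        (fun i => ∫ h, ((max (r i h) 0 : ℝ) : ℂ) * y (A h) ∂lam) 𝒰 (𝓝 (y x)) := fun r hr hle =>
    exists_tendsto_average hA hC hrel 𝒰 (fun i => (hr i).pos_part) (fun i h => le_max_right _ _) (by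
      filter_upwards [ha1] with i hi
      exact (integral_mono (hr i).pos_part (ha i).norm
        fun h => max_le (hle i h) (norm_nonneg _)).trans hi)
  have hre : ∀ i, Integrable (fun h => (a i h).re) lam := fun i => (ha i).re
  have him : ∀ i, Integrable (fun h => (a i h).im) lam := fun i => (ha i).im
  obtain ⟨x₁, h₁⟩ := hpart (fun i h => (a i h).re) hre fun i h => Complex.re_le_norm _
  obtain ⟨x₂, h₂⟩ := hpart (fun i h => -(a i h).re) (fun i => (hre i).neg) fun i h =>
    (neg_le_abs _).trans (Complex.abs_re_le_norm _)
  obtain ⟨x₃, h₃⟩ := hpart (fun i h => (a i h).im) him fun i h =>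
    (le_abs_self _).trans (Complex.abs_im_le_norm _)
  obtain ⟨x₄, h₄⟩ := hpart (fun i h => -(a i h).im) (fun i => (him i).neg) fun i h =>
    (neg_le_abs _).trans (Complex.abs_im_le_norm _)
  refine ⟨x₁ - x₂ + Complex.I • (x₃ - x₄), fun y => ?_⟩
  have hi : ∀ {r : H → ℝ}, Integrable r lam →
      Integrable (fun h => ((max (r h) 0 : ℝ) : ℂ) * y (A h)) lam := fun hr =>
    hr.pos_part.ofReal.mul_bdd (c := ‖y‖ * C) (hA y).aestronglyMeasurable
      (Eventually.of_forall fun h => (y.le_opNorm _).trans (by gcongr; exact hC h))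
  simp only [map_add, map_sub, map_smul, smul_eq_mul]
  refine (((h₁ y).sub (h₂ y)).add (((h₃ y).sub (h₄ y)).const_mul Complex.I)).congr fun i => ?_
  have j₁ := hi (hre i)
  have j₂ := hi (r := fun h => -(a i h).re) (hre i).neg
  have j₃ := hi (him i)
  have j₄ := hi (r := fun h => -(a i h).im) (him i).neg
  have j₁₂ : Integrable (fun h => ((max (a i h).re 0 : ℝ) : ℂ) * y (A h) -
      ((max (-(a i h).re) 0 : ℝ) : ℂ) * y (A h)) lam := j₁.sub j₂
  have j₃₄ : Integrable (fun h => Complex.I * (((max (a i h).im 0 : ℝ) : ℂ) * y (A h) -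
      ((max (-(a i h).im) 0 : ℝ) : ℂ) * y (A h))) lam := (j₃.sub j₄).const_mul _
  rw [← integral_sub j₁ j₂, ← integral_sub j₃ j₄, ← integral_const_mul, ← integral_add j₁₂ j₃₄]
  refine integral_congr_ae (Eventually.of_forall fun h => ?_)
  simp only
  rw [← sub_mul, ← sub_mul, ← Complex.ofReal_sub, ← Complex.ofReal_sub,
    max_zero_sub_max_neg_zero_eq_self, max_zero_sub_max_neg_zero_eq_self, ← mul_assoc, ← add_mul,
    mul_comm Complex.I, Complex.re_add_im]

/-- A weak*-continuous map whose range is relatively weakly compact is weakly continuous, because a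
weak limit is determined by its values on `X`. -/
theorem LCHypergroup.IsRelWeaklyCompact.continuous_of_continuous_eval {H : Type*}
    [TopologicalSpace H] {A : H → StrongDual ℂ X}
    (hrel : LCHypergroup.IsRelWeaklyCompact (range A)) (hA : ∀ b, Continuous fun h => A h b)
    (y : StrongDual ℂ (StrongDual ℂ X)) : Continuous fun h => y (A h) := by
  refine continuous_iff_continuousAt.2 fun x => (tendsto_iff_ultrafilter _ _ _).2 fun 𝒰 h𝒰 => ?_
  obtain ⟨ψ, -, hψ⟩ := hrel.exists_tendsto 𝒰 (u := A)
    (Eventually.of_forall fun h => subset_closure ⟨_, ⟨h, rfl⟩, rfl⟩)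
  have : ψ = A x := ContinuousLinearMap.ext fun b =>
    tendsto_nhds_unique (hψ (NormedSpace.inclusionInDoubleDual ℂ X b))
      (((hA b).tendsto x).mono_left h𝒰)
  simpa only [this] using hψ y

/-- Bounded ultrafilters on `X` converge weak* in the bidual, by the Banach-Alaoglu theorem. -/
theorem exists_bidual_tendsto {ι : Type*} (𝒱 : Ultrafilter ι) {u : ι → X}
    (hu : ∀ᶠ i in 𝒱, ‖u i‖ ≤ 1) :
    ∃ κ : StrongDual ℂ (StrongDual ℂ X), ∀ g : StrongDual ℂ X,
      Tendsto (fun i => g (u i)) 𝒱 (𝓝 (κ g)) := by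
  obtain ⟨κ, -, hκ⟩ := (WeakDual.isCompact_closedBall (𝕜 := ℂ)
    (0 : StrongDual ℂ (StrongDual ℂ X)) 1).ultrafilter_le_nhds
    (𝒱.map fun i => StrongDual.toWeakDual (NormedSpace.inclusionInDoubleDual ℂ X (u i)))
    (tendsto_principal.2 (by
      filter_upwards [hu] with i hi
      refine mem_closedBall_zero_iff.2 ?_
      exact (NormedSpace.double_dual_bound ℂ X (u i)).trans hi))
  exact ⟨WeakDual.toStrongDual κ, tendsto_iff_forall_eval_tendsto_topDualPairing.1 hκ⟩

end WeakCompactness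

namespace LCHypergroup

open Filter Set

set_option linter.unusedSectionVars false

variable {H : Type*} [TopologicalSpace H] [T2Space H] [LocallyCompactSpace H]
    [MeasurableSpace H] [BorelSpace H] [LCHypergroup H]

/-! ### Supports of convolutions and bump functions -/

/-- The support of `δ_x * δ_y`. -/
def supp (x y : H) : Set H := (conv x y : Measure H).support

theorem isCompact_supp (x y : H) : IsCompact (supp x y) := isCompact_support x y

theorem ae_mem_supp (x y : H) : ∀ᵐ t ∂(conv x y : Measure H), t ∈ supp x y :=
  have := regular_conv x y
  Measure.support_mem_ae_of_regular

theorem nonempty_supp (x y : H) : (supp x y).Nonempty := (ae_mem_supp x y).exists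

/-- Upper semicontinuity of the supports. -/
theorem eventually_supp_subset {U : Set H} (hU : IsOpen U) {x y : H} (h : supp x y ⊆ U) :
    ∀ᶠ p : H × H in 𝓝 (x, y), supp p.1 p.2 ⊆ U :=
  ((TopologicalSpace.Compacts.isOpen_subsets_of_isOpen hU).preimage
    continuous_support).mem_nhds h

theorem exists_isCompact_supp_subset {A : Set (H × H)} (hA : IsCompact A) :
    ∃ L : Set H, IsCompact L ∧ ∀ p ∈ A, supp p.1 p.2 ⊆ L := by
  refine hA.induction_on (p := fun A => ∃ L : Set H, IsCompact L ∧ ∀ p ∈ A, supp p.1 p.2 ⊆ L)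
    ⟨∅, isCompact_empty, by simp⟩ ?_ ?_ ?_
  · rintro s t hst ⟨L, hL, h⟩
    exact ⟨L, hL, fun p hp => h p (hst hp)⟩
  · rintro s t ⟨L, hL, h⟩ ⟨L', hL', h'⟩
    exact ⟨L ∪ L', hL.union hL', fun p hp => hp.elim (fun hp => (h p hp).trans subset_union_left)
      fun hp => (h' p hp).trans subset_union_right⟩
  · intro p _
    obtain ⟨L, hL, hpL⟩ := exists_compact_superset (isCompact_supp p.1 p.2)
    exact ⟨_, mem_nhdsWithin_of_mem_nhds (eventually_supp_subset isOpen_interior hpL), L, hL,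
      fun q hq => subset_trans hq interior_subset⟩

theorem evalConv_congr {𝕜 : Type*} [RCLike 𝕜] {f g : H → 𝕜} {x y : H}
    (h : ∀ t ∈ supp x y, f t = g t) : evalConv f x y = evalConv g x y :=
  integral_congr_ae ((ae_mem_supp x y).mono h)

theorem exists_mem_supp_of_evalConv_ne_zero {𝕜 : Type*} [RCLike 𝕜] {f : H → 𝕜} {x y : H}
    (h : evalConv f x y ≠ 0) : ∃ t ∈ supp x y, f t ≠ 0 := by
  by_contra! hcon
  exact h ((evalConv_congr (g := 0) hcon).trans (integral_zero _ _))

theorem integrable_conv_of_continuous {𝕜 : Type*} [RCLike 𝕜] {f : H → 𝕜} (hf : Continuous f)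
    (x y : H) : Integrable f (conv x y : Measure H) := by
  obtain ⟨M, hM⟩ := (isCompact_supp x y).exists_bound_of_continuousOn hf.continuousOn
  have := regular_conv x y
  refine Integrable.of_bound ?_ M ((ae_mem_supp x y).mono hM)
  rw [← Measure.restrict_eq_self_of_ae_mem (ae_mem_supp x y)]
  exact hf.continuousOn.aestronglyMeasurable_of_isCompact (isCompact_supp x y)
    (isCompact_supp x y).measurableSet

theorem evalConv_nonneg {f : H → ℝ} (hf : ∀ t, 0 ≤ f t) (x y : H) : 0 ≤ evalConv f x y :=
  integral_nonneg hf

theorem evalConv_pos {f : H → ℝ} (hf : Continuous f) (hf0 : ∀ t, 0 ≤ f t) {x y t : H}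
    (ht : t ∈ supp x y) (hft : 0 < f t) : 0 < evalConv f x y := by
  refine (integral_pos_iff_support_of_nonneg hf0 (integrable_conv_of_continuous hf x y)).2 ?_
  refine (Measure.mem_support_iff_forall t).1 ht _ ?_
  filter_upwards [(hf.tendsto t).eventually (lt_mem_nhds hft)] with s hs using hs.ne'

/-- The involution as a homeomorphism. -/
def involHomeomorph : H ≃ₜ H where
  toFun := invol
  invFun := invol
  left_inv := invol_invol
  right_inv := invol_invol
  continuous_toFun := continuous_invol
  continuous_invFun := continuous_invol

theorem evalConv_comp_invol {𝕜 : Type*} [RCLike 𝕜] (f : H → 𝕜) (x y : H) :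
    evalConv (fun t => f (invol t)) x y = evalConv f (invol y) (invol x) := by
  unfold evalConv
  rw [← map_invol_conv x y]
  exact (integral_map_equiv (involHomeomorph (H := H)).toMeasurableEquiv f).symm

theorem invol_mem_supp {x y t : H} (h : t ∈ supp x y) :
    invol t ∈ supp (invol y) (invol x) := by
  refine (Measure.mem_support_iff_forall _).2 fun U hU => ?_
  rw [← map_invol_conv x y]
  refine lt_of_lt_of_eq ((Measure.mem_support_iff_forall t).1 h _
    (continuous_invol.continuousAt.preimage_mem_nhds hU)) ?_
  exact ((involHomeomorph (H := H)).toMeasurableEquiv.map_apply U).symm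

theorem supp_e_right (x : H) : supp x e = {x} := by
  refine subset_antisymm (fun t ht => ?_) ?_
  · by_contra hne
    have := (Measure.mem_support_iff_forall t).1 ht {x}ᶜ (isOpen_compl_singleton.mem_nhds hne)
    rw [conv_e, Measure.dirac_apply' _ (measurableSet_singleton x).compl] at this
    simp at this
  · rw [singleton_subset_iff]
    refine (Measure.mem_support_iff_forall x).2 fun U hU => ?_
    rw [conv_e, Measure.dirac_apply_of_mem (mem_of_mem_nhds hU)]
    exact one_pos

theorem invol_e : invol (e : H) = e := by
  have : (e : H) ∈ supp e e := by rw [supp_e_right]; rfl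
  exact ((e_mem_support (e : H) e).1 this).symm

theorem evalConv_ofReal (f : H → ℝ) (x y : H) :
    evalConv (fun t => (f t : ℂ)) x y = ((evalConv f x y : ℝ) : ℂ) :=
  integral_complex_ofReal

/-- Associativity, for the triple product `f (x * y * z)` of a real function. -/
theorem evalConv_assoc (f : C_c(H, ℝ)) (x y z : H) :
    evalConv (fun u => evalConv f u z) x y = evalConv (fun v => evalConv f x v) y z := by
  obtain ⟨M, hM⟩ := f.continuous.bounded_above_of_compact_support f.hasCompactSupport
  have := assoc x y z (BoundedContinuousFunction.ofNormedAddCommGroup (fun t => (f t : ℂ))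
    (by fun_prop) M (fun t => by simpa using hM t))
  change evalConv (fun u => evalConv (fun t => (f t : ℂ)) u z) x y =
    evalConv (fun v => evalConv (fun t => (f t : ℂ)) x v) y z at this
  simp only [evalConv_ofReal] at this
  exact_mod_cast this

theorem continuous_evalConv_left {𝕜 : Type*} [RCLike 𝕜] (f : C_c(H, 𝕜)) (x : H) :
    Continuous (evalConv (H := H) f x) :=
  (continuous_uncurry_evalConv f).comp (by fun_prop : Continuous fun y => (x, y))

theorem exists_bump {x : H} {U : Set H} (hU : U ∈ 𝓝 x) :
    ∃ f : C_c(H, ℝ), (∀ t, 0 ≤ f t) ∧ 0 < f x ∧ ∀ t, f t ≠ 0 → t ∈ U := by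
  obtain ⟨χ, hχ1, hχ0, hχc, hχ⟩ := exists_continuous_one_zero_of_isCompact
    (isCompact_singleton (x := x)) isOpen_interior.isClosed_compl (disjoint_compl_right_iff_subset.2
      (singleton_subset_iff.2 (mem_interior_iff_mem_nhds.2 hU)))
  refine ⟨⟨χ, hχc⟩, fun t => (hχ t).1, ?_, fun t ht => ?_⟩
  · change 0 < χ x
    rw [hχ1 rfl]; exact one_pos
  · by_contra htU
    exact ht (hχ0 fun h => htU (interior_subset h))

/-- Reversibility: `z ∈ supp (x * y)` implies `y ∈ supp (x̌ * z)`. Indeed `e ∈ supp (ž * z)`, so by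
associativity `e` is in the closed set `supp (ž * x * y)`, so that `e ∈ supp (u * y)` for some
`u ∈ supp (ž * x)`; but this forces `u = y̌`. -/
theorem mem_supp_invol_left {x y z : H} (hz : z ∈ supp x y) : y ∈ supp (invol x) z := by
  suffices h : invol y ∈ supp (invol z) x by
    simpa [invol_invol] using invol_mem_supp h
  by_contra hcon
  -- otherwise `e ∉ supp (u * y)` for all `u ∈ supp (ž * x)`, and by compactness the same holds for
  -- all points close to `e`
  have hfar : ∀ᶠ t in 𝓝 (e : H), ∀ u ∈ supp (invol z) x, t ∉ supp u y := by
    refine (isCompact_supp (invol z) x).eventually_forall_of_forall_eventually fun u hu => ?_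
    have he : e ∉ supp u y := fun h => hcon ((e_mem_support u y).1 h ▸ hu)
    obtain ⟨V, W, hV, hW, hKV, heW, hVW⟩ :=
      SeparatedNhds.of_isCompact_isCompact (isCompact_supp u y) (isCompact_singleton (x := (e : H)))
        (disjoint_singleton_right.2 he)
    have h1 : ∀ᶠ p : H × H in 𝓝 (e, u), supp p.2 y ⊆ V :=
      (show Continuous fun p : H × H => (p.2, y) by fun_prop).continuousAt.eventually
        (eventually_supp_subset hV hKV)
    have h2 : ∀ᶠ p : H × H in 𝓝 (e, u), p.1 ∈ W :=
      continuous_fst.continuousAt.eventually (hW.mem_nhds (heW rfl))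
    filter_upwards [h1, h2] with p hp1 hp2 hp
    exact hVW.le_bot ⟨hp1 hp, hp2⟩
  obtain ⟨f, hf0, hfe, hfU⟩ := exists_bump hfar
  have h1 : evalConv (fun u => evalConv f u y) (invol z) x = 0 := by
    by_contra hne
    obtain ⟨u, hu, hne⟩ := exists_mem_supp_of_evalConv_ne_zero hne
    obtain ⟨t, ht, hft⟩ := exists_mem_supp_of_evalConv_ne_zero hne
    exact hfU t hft u hu ht
  rw [evalConv_assoc] at h1
  refine (evalConv_pos (continuous_evalConv_left f _) (fun v => evalConv_nonneg hf0 _ _) hz ?_).ne'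
    h1
  exact evalConv_pos f.continuous hf0 ((e_mem_support _ _).2 rfl) hfe

theorem mem_supp_invol_right {x y z : H} (hz : z ∈ supp x y) : x ∈ supp z (invol y) := by
  have := invol_mem_supp (mem_supp_invol_left (invol_mem_supp hz))
  simpa [invol_invol] using this

variable {lam : Measure H}

theorem integrable_evalConv (h : IsLeftHaar lam) (f : C_c(H, ℝ)) (hf : ∀ t, 0 ≤ f t) (x : H) :
    Integrable (evalConv f x) lam := by
  have := h.regular
  refine ⟨(continuous_evalConv_left f x).aestronglyMeasurable, ?_⟩
  have hfi : Integrable f lam := f.continuous.integrable_of_hasCompactSupport f.hasCompactSupport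
  rw [hasFiniteIntegral_iff_ofReal (Eventually.of_forall (evalConv_nonneg hf x)),
    lintegral_evalConv h f hf, ← ofReal_integral_eq_lintegral_ofReal hfi (Eventually.of_forall hf)]
  exact ENNReal.ofReal_lt_top

theorem integral_evalConv (h : IsLeftHaar lam) (f : C_c(H, ℝ)) (hf : ∀ t, 0 ≤ f t) (x : H) :
    ∫ y, evalConv f x y ∂lam = ∫ y, f y ∂lam := by
  rw [integral_eq_lintegral_of_nonneg_ae (Eventually.of_forall (evalConv_nonneg hf x))
    (continuous_evalConv_left f x).aestronglyMeasurable, lintegral_evalConv h f hf,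
    ← integral_eq_lintegral_of_nonneg_ae (Eventually.of_forall hf)
      f.continuous.aestronglyMeasurable]

/-- The support of a left Haar measure is all of `H`: if `lam` vanishes near `u`, then it vanishes
near every `z`, because `u ∈ supp (x * z)` for some `x`, namely for the `x ∈ supp (u * ž)`. -/
theorem IsLeftHaar.isOpenPosMeasure (h : IsLeftHaar lam) : lam.IsOpenPosMeasure := by
  have := h.regular
  refine ⟨fun U hU ⟨u, hu⟩ hU0 => h.ne_zero ?_⟩
  obtain ⟨f, hf0, hfu, hfU⟩ := exists_bump (hU.mem_nhds hu)
  have hfint : ∫ y, f y ∂lam = 0 := by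
    refine integral_eq_zero_of_ae ?_
    filter_upwards [measure_eq_zero_iff_ae_notMem.1 hU0] with t ht
    by_contra hne
    exact ht (hfU t hne)
  have hz : ∀ z, z ∉ lam.support := fun z => by
    obtain ⟨x, hx⟩ := nonempty_supp u (invol z)
    have hux : u ∈ supp x z := by simpa [invol_invol] using mem_supp_invol_right hx
    refine Measure.notMem_support_iff_exists.2 ⟨{y | 0 < evalConv f x y},
      (continuous_evalConv_left f x).tendsto z |>.eventually
        (lt_mem_nhds (evalConv_pos f.continuous hf0 hux hfu)), ?_⟩
    have := (integral_eq_zero_iff_of_nonneg (evalConv_nonneg hf0 x)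
      (integrable_evalConv h f hf0 x)).1 ((integral_evalConv h f hf0 x).trans hfint)
    exact measure_eq_zero_iff_ae_notMem.2 (this.mono fun y hy => by
      simp only [mem_ofPred_eq, not_lt]; exact hy.le)
  have hs : lam.supportᶜ = univ := eq_univ_of_forall hz
  rw [← Measure.measure_univ_eq_zero, ← hs]
  exact Measure.measure_compl_support_of_regular

/-- `k` is a nonnegative function of mass one that vanishes off `V`. Usually `V` is a small
neighbourhood of some point. -/
structure IsBump (lam : Measure H) (V : Set H) (k : C_c(H, ℝ)) : Prop where
  nonneg : ∀ t, 0 ≤ k t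
  integral_eq_one : ∫ t, k t ∂lam = 1
  mem_of_ne_zero : ∀ t, k t ≠ 0 → t ∈ V

theorem IsBump.mono {V W : Set H} {k : C_c(H, ℝ)} (hk : IsBump lam V k) (h : V ⊆ W) :
    IsBump lam W k :=
  ⟨hk.nonneg, hk.integral_eq_one, fun t ht => h (hk.mem_of_ne_zero t ht)⟩

theorem isBump_inv_smul (h : IsLeftHaar lam) {V : Set H} {f : C_c(H, ℝ)} (hf0 : ∀ t, 0 ≤ f t)
    {x : H} (hfx : 0 < f x) (hfV : ∀ t, f t ≠ 0 → t ∈ V) :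
    IsBump lam V ((∫ t, f t ∂lam)⁻¹ • f) := by
  have := h.regular
  have := h.isOpenPosMeasure
  have hpos : 0 < ∫ t, f t ∂lam :=
    f.continuous.integral_pos_of_hasCompactSupport_nonneg_nonzero f.hasCompactSupport hf0 hfx.ne'
  refine ⟨fun t => mul_nonneg (inv_nonneg.2 hpos.le) (hf0 t), ?_, fun t ht => hfV t fun h0 => ht ?_⟩
  · simp only [CompactlySupportedContinuousMap.smul_apply, smul_eq_mul]
    rw [integral_const_mul, inv_mul_cancel₀ hpos.ne']
  · simp [h0]

theorem exists_isBump (h : IsLeftHaar lam) {x : H} {V : Set H} (hV : V ∈ 𝓝 x) :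
    ∃ k, IsBump lam V k := by
  obtain ⟨f, hf0, hfx, hfV⟩ := exists_bump hV
  exact ⟨_, isBump_inv_smul h hf0 hfx hfV⟩

/-- The function `t ↦ f ť`. -/
def compInvol {𝕜 : Type*} [RCLike 𝕜] (f : C_c(H, 𝕜)) : C_c(H, 𝕜) :=
  ⟨⟨fun t => f (invol t), f.continuous.comp continuous_invol⟩,
    f.hasCompactSupport.comp_homeomorph involHomeomorph⟩

theorem exists_isBump_symm (h : IsLeftHaar lam) {V : Set H} (hV : V ∈ 𝓝 (e : H)) :
    ∃ k, IsBump lam V k ∧ ∀ t, k (invol t) = k t := by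
  have hV' : V ∩ invol ⁻¹' V ∈ 𝓝 (e : H) :=
    inter_mem hV (continuous_invol.continuousAt.preimage_mem_nhds (by rwa [invol_e]))
  obtain ⟨f, hf0, hfe, hfV⟩ := exists_bump hV'
  have hc : ∀ t, compInvol f t = f (invol t) := fun t => rfl
  refine ⟨_, isBump_inv_smul h (f := f + compInvol f) (x := e)
    (fun t => add_nonneg (hf0 t) (hf0 _)) ?_ fun t ht => ?_, fun t => ?_⟩
  · simp only [CompactlySupportedContinuousMap.add_apply, hc, invol_e]; linarith
  · by_cases h1 : f t = 0
    · have h2 : f (invol t) ≠ 0 := fun h2 => ht (by simp [hc, h1, h2])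
      have := (hfV _ h2).2
      simpa [invol_invol] using this
    · exact (hfV _ h1).1
  · simp [hc, invol_invol, add_comm]

/-! ### The adjoint relation of the translations -/

/-- The function `u ↦ ∫ f(s) k(ǔ * s) dlam(s)`. For a symmetric `k` it is the convolution `f * k`; for
a bump function `k` at `e` it approximates `f`. -/
noncomputable def smear (lam : Measure H) (k : C_c(H, ℝ)) (f : H → ℂ) (u : H) : ℂ :=
  ∫ s, f s * ((evalConv k (invol u) s : ℝ) : ℂ) ∂lam

theorem continuous_smear [lam.Regular] (k : C_c(H, ℝ)) {f : H → ℂ} (hf : Integrable f lam) :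
    Continuous (smear lam k f) := by
  obtain ⟨M, hM⟩ := exists_bound_evalConv (H := H) k
  have hc := continuous_uncurry_evalConv (H := H) k
  exact continuous_integral_mul (G := fun u s => ((evalConv k (invol u) s : ℝ) : ℂ)) (M := M)
    (Complex.continuous_ofReal.comp (hc.comp
      ((continuous_invol.comp continuous_fst).prodMk continuous_snd)))
    (fun u s => by simpa using hM (invol u) s) hf

theorem exists_bound_smear (k : C_c(H, ℝ)) {f : H → ℂ} (hf : Integrable f lam) :
    ∃ M, ∀ u, ‖smear lam k f u‖ ≤ M := by
  obtain ⟨M, hM⟩ := exists_bound_evalConv (H := H) k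
  exact ⟨_, fun u => norm_integral_mul_le (G := fun s => ((evalConv k (invol u) s : ℝ) : ℂ)) hf
    fun s => by simpa using hM (invol u) s⟩

/-- Only the points `s ∈ supp (u * v)` with `v` close to `e` contribute to `smear lam k f u`, and
these are close to `u`. -/
theorem exists_nhds_norm_smear_sub_le (h : IsLeftHaar lam) (f : C_c(H, ℂ)) {C : Set H}
    (hC : IsCompact C) {ε : ℝ} (hε : 0 < ε) :
    ∃ V ∈ 𝓝 (e : H), ∀ k, IsBump lam V k → ∀ u ∈ C, ‖smear lam k f u - f u‖ ≤ ε := by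
  have hnear : ∀ᶠ v in 𝓝 (e : H), ∀ u ∈ C, ∀ s ∈ supp u v, ‖f s - f u‖ ≤ ε := by
    refine hC.eventually_forall_of_forall_eventually fun u hu => ?_
    have hopen : IsOpen {s | dist (f s) (f u) < ε / 2} :=
      isOpen_lt (f.continuous.dist continuous_const) continuous_const
    have h1 : ∀ᶠ p : H × H in 𝓝 (e, u), supp p.2 p.1 ⊆ {s | dist (f s) (f u) < ε / 2} :=
      (show Continuous fun p : H × H => (p.2, p.1) by fun_prop).continuousAt.eventually
        (eventually_supp_subset hopen (by
          rw [supp_e_right, singleton_subset_iff]; simpa using hε))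
    have h2 : ∀ᶠ p : H × H in 𝓝 (e, u), dist (f p.2) (f u) < ε / 2 :=
      continuous_snd.continuousAt.eventually (hopen.mem_nhds (by simpa using hε))
    filter_upwards [h1, h2] with p hp1 hp2 s hs
    have := hp1 hs
    rw [← dist_eq_norm]
    have := dist_triangle_right (f s) (f p.2) (f u)
    simp only [mem_ofPred_eq] at *
    linarith
  refine ⟨_, hnear, fun k hk u hu => ?_⟩
  have hki := integrable_evalConv h k hk.nonneg (invol u)
  have hkc := continuous_evalConv_left k (invol u)
  obtain ⟨M, hM⟩ := f.continuous.bounded_above_of_compact_support f.hasCompactSupport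
  have hone : ∫ s, evalConv k (invol u) s ∂lam = 1 :=
    (integral_evalConv h k hk.nonneg _).trans hk.integral_eq_one
  have hfu : f u = ∫ s, f u * ((evalConv k (invol u) s : ℝ) : ℂ) ∂lam := by
    rw [integral_const_mul, integral_complex_ofReal, hone]; simp
  have hi1 : Integrable (fun s => f s * ((evalConv k (invol u) s : ℝ) : ℂ)) lam :=
    hki.ofReal.bdd_mul (c := M) f.continuous.aestronglyMeasurable (Eventually.of_forall hM)
  have hi2 : Integrable (fun s => f u * ((evalConv k (invol u) s : ℝ) : ℂ)) lam :=
    hki.ofReal.const_mul _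
  rw [hfu, smear, ← integral_sub hi1 hi2]
  calc _ ≤ ∫ s, ε * evalConv k (invol u) s ∂lam := by
        refine norm_integral_le_of_norm_le (hki.const_mul ε) (Eventually.of_forall fun s => ?_)
        rw [← sub_mul, norm_mul, Complex.norm_real,
          Real.norm_of_nonneg (evalConv_nonneg hk.nonneg _ _)]
        rcases eq_or_ne (evalConv k (invol u) s) 0 with h0 | h0
        · simp [h0]
        · obtain ⟨v, hv, hkv⟩ := exists_mem_supp_of_evalConv_ne_zero h0
          have hs : s ∈ supp u v := by
            simpa [invol_invol] using mem_supp_invol_left hv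
          exact mul_le_mul_of_nonneg_right (hk.mem_of_ne_zero v hkv u hu s hs)
            (evalConv_nonneg hk.nonneg _ _)
    _ = ε := by rw [integral_const_mul, hone, mul_one]

/-- Integrals against `δ_x * δ_y` of a function depending on a parameter are jointly continuous. -/
theorem continuous_evalConv_param {Z : Type*} [TopologicalSpace Z] {G : Z → H → ℂ}
    (hG : Continuous (Function.uncurry G)) {M : ℝ} (hM : ∀ z u, ‖G z u‖ ≤ M) :
    Continuous fun q : Z × H × H => evalConv (G q.1) q.2.1 q.2.2 := by
  have hGz : ∀ z, Continuous (G z) := fun z => hG.comp (by fun_prop : Continuous fun u => (z, u))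
  refine Metric.continuous_iff'.2 fun ⟨z, x, y⟩ ε hε => ?_
  obtain ⟨L, hL, hxyL⟩ := exists_compact_superset (isCompact_supp x y)
  have h1 : ∀ᶠ q : Z × H × H in 𝓝 (z, x, y), supp q.2.1 q.2.2 ⊆ L :=
    (continuous_snd.continuousAt.eventually (eventually_supp_subset isOpen_interior hxyL)).mono
      fun q hq => subset_trans hq interior_subset
  have h2 : ∀ᶠ z' in 𝓝 z, ∀ u ∈ L, dist (G z' u) (G z u) < ε / 2 := by
    refine hL.eventually_forall_of_forall_eventually fun u hu => ?_
    have hc : Continuous fun p : Z × H => dist (G p.1 p.2) (G z p.2) :=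
      hG.dist ((hGz z).comp continuous_snd)
    exact hc.continuousAt.eventually (gt_mem_nhds (by simpa using hε))
  have h3 : ∀ᶠ q : Z × H × H in 𝓝 (z, x, y),
      dist (evalConv (G z) q.2.1 q.2.2) (evalConv (G z) x y) < ε / 2 := by
    have hc := continuous_evalConv (BoundedContinuousFunction.ofNormedAddCommGroup (G z) (hGz z) M
      (hM z))
    exact Metric.tendsto_nhds.1 ((hc.comp continuous_snd).tendsto (z, x, y)) _ (by positivity)
  filter_upwards [h1, continuous_fst.continuousAt.eventually h2, h3] with q hq1 hq2 hq3
  have hle : dist (evalConv (G q.1) q.2.1 q.2.2) (evalConv (G z) q.2.1 q.2.2) ≤ ε / 2 := by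
    rw [dist_eq_norm]
    unfold evalConv
    rw [← integral_sub (integrable_conv_of_continuous (hGz _) _ _)
      (integrable_conv_of_continuous (hGz _) _ _)]
    refine (norm_integral_le_of_norm_le_const (C := ε / 2)
      ((ae_mem_supp q.2.1 q.2.2).mono fun u hu => ?_)).trans (by simp)
    rw [← dist_eq_norm]
    exact (hq2 u (hq1 hu)).le
  have := dist_triangle (evalConv (G q.1) q.2.1 q.2.2) (evalConv (G z) q.2.1 q.2.2)
    (evalConv (G z) x y)
  linarith

theorem exists_cutoff {L : Set H} (hL : IsCompact L) :
    ∃ χ : C_c(H, ℂ), (∀ t ∈ L, χ t = 1) ∧ ∀ t, ‖χ t‖ ≤ 1 := by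
  obtain ⟨χ, hχ1, -, hχc, hχ⟩ := exists_continuous_one_zero_of_isCompact hL isClosed_empty
    (disjoint_empty L)
  refine ⟨(⟨χ, hχc⟩ : C_c(H, ℝ)).compLeft ⟨fun r : ℝ => (r : ℂ), by fun_prop⟩,
    fun t ht => ?_, fun t => ?_⟩
  · simp [CompactlySupportedContinuousMap.compLeft_apply, hχ1 ht]
  · have := hχ t
    simp only [CompactlySupportedContinuousMap.compLeft_apply, ContinuousMap.coe_mk,
      Complex.ofReal_zero, Complex.norm_real]
    change |χ t| ≤ 1
    exact abs_le.2 ⟨by linarith [this.1], this.2⟩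

/-- Fubini's theorem for `lam`, which need not be σ-finite, and `δ_x * δ_y`. Multiplying by a cutoff
function that is `1` on the support of `δ_x * δ_y` gives an integrand with compact support. -/
theorem integral_evalConv_swap [lam.Regular] {F : H → H → ℂ}
    (hF : Continuous (Function.uncurry F)) {A : Set H} (hA : IsCompact A)
    (hFA : ∀ s ∉ A, ∀ u, F s u = 0) (x y : H) :
    ∫ s, evalConv (F s) x y ∂lam = evalConv (fun u => ∫ s, F s u ∂lam) x y := by
  have := regular_conv x y
  obtain ⟨χ, hχ, -⟩ := exists_cutoff (isCompact_supp x y)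
  have hsupp : HasCompactSupport (Function.uncurry fun s u => χ u * F s u) := by
    refine HasCompactSupport.intro (hA.prod χ.hasCompactSupport) fun p hp => ?_
    by_cases h1 : p.1 ∈ A
    · have : p.2 ∉ tsupport χ := fun h2 => hp ⟨h1, h2⟩
      simp [Function.uncurry, image_eq_zero_of_notMem_tsupport this]
    · simp [Function.uncurry, hFA _ h1]
  have hcont : Continuous (Function.uncurry fun s u => χ u * F s u) :=
    (χ.continuous.comp continuous_snd).mul hF
  have e1 : ∀ s, evalConv (F s) x y = evalConv (fun u => χ u * F s u) x y := fun s =>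
    evalConv_congr fun u hu => by rw [hχ u hu, one_mul]
  have e2 : evalConv (fun u => ∫ s, F s u ∂lam) x y =
      evalConv (fun u => ∫ s, χ u * F s u ∂lam) x y :=
    evalConv_congr fun u hu => by simp [hχ u hu]
  simp_rw [e1]
  rw [e2]
  exact integral_integral_swap_of_hasCompactSupport hcont hsupp

theorem evalConv_invol_comm {k : C_c(H, ℝ)} (hk : ∀ t, k (invol t) = k t) (s u : H) :
    evalConv k (invol s) u = evalConv k (invol u) s := by
  have := evalConv_comp_invol k (invol s) u
  rw [invol_invol] at this
  rw [← this]
  simp only [hk]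

/-- The approximate form of the adjoint relation: both sides are the integral of
`f(s) g(y) k(š * x * y)`, evaluated with the two ways of placing the brackets. -/
theorem integral_mul_evalConv_smear [lam.Regular] (f g : C_c(H, ℂ)) {k : C_c(H, ℝ)}
    (hk : ∀ t, k (invol t) = k t) (x : H) :
    ∫ y, g y * evalConv (smear lam k f) x y ∂lam =
      ∫ s, f s * evalConv (smear lam k g) (invol x) s ∂lam := by
  have hkc := continuous_uncurry_evalConv (H := H) k
  obtain ⟨M, hM⟩ := exists_bound_evalConv (H := H) k
  have hsymm := evalConv_invol_comm hk
  set W : H → H → ℂ := fun s y => evalConv (fun u => ((evalConv k (invol s) u : ℝ) : ℂ)) x y with hW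
  have hWc : Continuous (Function.uncurry W) :=
    (continuous_evalConv_param (G := fun s u => ((evalConv k (invol s) u : ℝ) : ℂ)) (M := M)
      (Complex.continuous_ofReal.comp (hkc.comp
        ((continuous_invol.comp continuous_fst).prodMk continuous_snd)))
      (fun s u => by simpa using hM _ _)).comp
      (show Continuous fun p : H × H => (p.1, x, p.2) by fun_prop)
  have hW' : ∀ s y, W s y = evalConv (fun v => ((evalConv k v y : ℝ) : ℂ)) (invol s) x :=
    fun s y => by
      rw [hW]
      simp only [evalConv_ofReal]
      rw [evalConv_assoc]
  have hA : ∀ (f : C_c(H, ℂ)), ∀ s ∉ tsupport f, f s = 0 := fun f s hs =>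
    image_eq_zero_of_notMem_tsupport hs
  have e1 : ∀ y, evalConv (smear lam k f) x y = ∫ s, f s * W s y ∂lam := fun y => by
    have := integral_evalConv_swap (lam := lam)
      (F := fun s u => f s * ((evalConv k (invol u) s : ℝ) : ℂ))
      ((f.continuous.comp continuous_fst).mul (Complex.continuous_ofReal.comp (hkc.comp
        ((continuous_invol.comp continuous_snd).prodMk continuous_fst))))
      f.hasCompactSupport (fun s hs u => by simp [hA f s hs]) x y
    refine Eq.trans this.symm (integral_congr_ae (Eventually.of_forall fun s => ?_))
    simp only [hW, hsymm s]
    exact integral_const_mul _ _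
  have e2 : ∀ s, evalConv (smear lam k g) (invol x) s = ∫ y, g y * W s y ∂lam := fun s => by
    have := integral_evalConv_swap (lam := lam)
      (F := fun y v => g y * ((evalConv k v y : ℝ) : ℂ))
      ((g.continuous.comp continuous_fst).mul (Complex.continuous_ofReal.comp (hkc.comp
        (continuous_snd.prodMk continuous_fst))))
      g.hasCompactSupport (fun s hs u => by simp [hA g s hs]) (invol s) x
    have h2 := evalConv_comp_invol (smear lam k g) (invol s) x
    rw [invol_invol] at h2
    rw [← h2]
    simp only [smear, invol_invol]
    refine Eq.trans this.symm (integral_congr_ae (Eventually.of_forall fun y => ?_))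
    simp only [hW']
    exact integral_const_mul _ _
  simp_rw [e1, e2, ← integral_const_mul]
  have hsw := integral_integral_swap_of_hasCompactSupport (μ := lam) (ν := lam)
    (f := fun y s => g y * (f s * W s y))
    ((g.continuous.comp continuous_fst).mul ((f.continuous.comp continuous_snd).mul
      (hWc.comp continuous_swap)))
    (HasCompactSupport.intro (g.hasCompactSupport.prod f.hasCompactSupport) fun p hp => by
      by_cases h1 : p.1 ∈ tsupport g
      · have : p.2 ∉ tsupport f := fun h2 => hp ⟨h1, h2⟩
        simp [Function.uncurry, hA f _ this]
      · simp [Function.uncurry, hA g _ h1])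
  rw [hsw]
  simp only [mul_left_comm]

theorem norm_integral_mul_evalConv_smear_sub_le [lam.Regular] (f g : C_c(H, ℂ)) (k : C_c(H, ℝ))
    {x : H} {L : Set H} (hL : ∀ y ∈ tsupport g, supp x y ⊆ L) {ε : ℝ}
    (hk : ∀ u ∈ L, ‖smear lam k f u - f u‖ ≤ ε) :
    ‖∫ y, g y * evalConv (smear lam k f) x y ∂lam - ∫ y, g y * evalConv f x y ∂lam‖ ≤
      (∫ y, ‖g y‖ ∂lam) * ε := by
  have hfi : Integrable f lam := f.continuous.integrable_of_hasCompactSupport f.hasCompactSupport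
  have hgi : Integrable g lam := g.continuous.integrable_of_hasCompactSupport g.hasCompactSupport
  have hsc := continuous_smear k hfi
  obtain ⟨M, hM⟩ := exists_bound_smear k hfi
  obtain ⟨M', hM'⟩ := exists_bound_evalConv (H := H) f
  let S : H →ᵇ ℂ := BoundedContinuousFunction.ofNormedAddCommGroup (smear lam k f) hsc M hM
  have hi1 : Integrable (fun y => g y * evalConv (smear lam k f) x y) lam :=
    integrable_mul_of_bounded hgi ((continuous_evalConv S).comp
      (by fun_prop : Continuous fun y => (x, y))) fun y => norm_evalConv_le S x y
  have hi2 : Integrable (fun y => g y * evalConv f x y) lam :=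
    integrable_mul_of_bounded hgi (continuous_evalConv_left f x) (hM' x)
  rw [← integral_sub hi1 hi2, ← integral_mul_const]
  refine norm_integral_le_of_norm_le (hgi.norm.mul_const ε) (Eventually.of_forall fun y => ?_)
  rw [← mul_sub, norm_mul]
  by_cases hy : y ∈ tsupport g
  · refine mul_le_mul_of_nonneg_left ?_ (norm_nonneg _)
    unfold evalConv
    rw [← integral_sub (integrable_conv_of_continuous hsc _ _) (integrable_conv f _ _)]
    exact (norm_integral_le_of_norm_le_const (C := ε)
      ((ae_mem_supp x y).mono fun u hu => hk u (hL y hy hu))).trans (by simp)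
  · simp [image_eq_zero_of_notMem_tsupport hy]

/-- The adjoint relation of the left translations: `∫ g(y) f(x * y) dy = ∫ f(s) g(x̌ * s) ds`. -/
theorem integral_mul_evalConv_comm (h : IsLeftHaar lam) (f g : C_c(H, ℂ)) (x : H) :
    ∫ y, g y * evalConv f x y ∂lam = ∫ s, f s * evalConv g (invol x) s ∂lam := by
  have := h.regular
  obtain ⟨L, hL, hLg⟩ := exists_isCompact_supp_subset
    ((isCompact_singleton (x := x)).prod g.hasCompactSupport.isCompact)
  obtain ⟨L', hL', hLf⟩ := exists_isCompact_supp_subset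
    ((isCompact_singleton (x := invol x)).prod f.hasCompactSupport.isCompact)
  rw [← sub_eq_zero, ← norm_le_zero_iff]
  set c := ∫ y, ‖g y‖ ∂lam + ∫ s, ‖f s‖ ∂lam with hc
  have hc0 : 0 ≤ c := by positivity
  refine le_of_forall_pos_le_add fun ε hε => ?_
  have hδ : 0 < ε / (c + 1) := by positivity
  obtain ⟨V, hV, hVk⟩ := exists_nhds_norm_smear_sub_le h f hL hδ
  obtain ⟨V', hV', hVk'⟩ := exists_nhds_norm_smear_sub_le h g hL' hδ
  obtain ⟨k, hk, hks⟩ := exists_isBump_symm h (inter_mem hV hV')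
  have h1 := norm_integral_mul_evalConv_smear_sub_le (lam := lam) f g k
    (fun y hy => hLg (x, y) ⟨rfl, hy⟩) (hVk k (hk.mono inter_subset_left))
  have h2 := norm_integral_mul_evalConv_smear_sub_le (lam := lam) g f k
    (fun y hy => hLf (invol x, y) ⟨rfl, hy⟩) (hVk' k (hk.mono inter_subset_right))
  rw [integral_mul_evalConv_smear f g hks] at h1
  rw [norm_sub_rev] at h1
  calc _ ≤ _ := norm_sub_le_norm_sub_add_norm_sub _ _ _
    _ ≤ c * (ε / (c + 1)) := by rw [hc, add_mul]; exact add_le_add h1 h2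
    _ ≤ (c + 1) * (ε / (c + 1)) := by gcongr; linarith
    _ = 0 + ε := by field_simp; ring

/-! ### The convolution of `L¹(H)` -/

theorem norm_integral_mul_coe_le (b : Lp ℂ 1 lam) {G : H → ℂ} {M : ℝ} (hM : ∀ y, ‖G y‖ ≤ M) :
    ‖∫ y, b y * G y ∂lam‖ ≤ M * ‖b‖ := by
  rw [L1.norm_eq_integral_norm]
  exact norm_integral_mul_le (L1.integrable_coeFn b) hM

theorem integrable_cc [lam.Regular] (g : C_c(H, ℂ)) : Integrable g lam :=
  g.continuous.integrable_of_hasCompactSupport g.hasCompactSupport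

variable (lam) in
/-- The class in `L¹(H)` of a continuous function with compact support. -/
noncomputable def ccToL1 [lam.Regular] (g : C_c(H, ℂ)) : Lp ℂ 1 lam := (integrable_cc g).toL1 g

theorem coeFn_ccToL1 [lam.Regular] (g : C_c(H, ℂ)) : ccToL1 lam g =ᵐ[lam] g :=
  (integrable_cc g).coeFn_toL1

theorem norm_ccToL1 [lam.Regular] (g : C_c(H, ℂ)) : ‖ccToL1 lam g‖ = ∫ t, ‖g t‖ ∂lam := by
  rw [L1.norm_eq_integral_norm]
  exact integral_congr_ae ((coeFn_ccToL1 g).mono fun t ht => by simp only [ht])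

theorem integral_ccToL1_mul [lam.Regular] (g : C_c(H, ℂ)) (G : H → ℂ) :
    ∫ t, ccToL1 lam g t * G t ∂lam = ∫ t, g t * G t ∂lam :=
  integral_congr_ae ((coeFn_ccToL1 g).mono fun t ht => by simp only [ht])

theorem norm_sub_eq_integral (a b : Lp ℂ 1 lam) : ‖a - b‖ = ∫ t, ‖a t - b t‖ ∂lam := by
  rw [L1.norm_eq_integral_norm]
  exact integral_congr_ae ((Lp.coeFn_sub a b).mono fun t ht => by simp only [ht, Pi.sub_apply])

/-- `C_c(H)` is dense in `L¹(H)`. The version in Mathlib is about normal spaces. -/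
theorem exists_integral_norm_sub_le [lam.Regular] {f : H → ℂ} (hf : Integrable f lam) :
    ∀ ε > 0, ∃ g : C_c(H, ℂ), ∫ t, ‖f t - g t‖ ∂lam ≤ ε := by
  refine Integrable.induction (P := fun f => ∀ ε > 0, ∃ g : C_c(H, ℂ), ∫ t, ‖f t - g t‖ ∂lam ≤ ε)
    ?_ ?_ ?_ ?_ hf
  · intro c s hs hsfin ε hε
    have hδ : ENNReal.ofReal (ε / (‖c‖ + 1)) ≠ 0 := (ENNReal.ofReal_pos.2 (by positivity)).ne'
    obtain ⟨K, hKs, hK, hKl⟩ := hs.exists_isCompact_sdiff_lt hsfin.ne (ENNReal.half_pos hδ).ne'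
    obtain ⟨U, hsU, hU, -, hUl⟩ := hs.exists_isOpen_sdiff_lt hsfin.ne (ENNReal.half_pos hδ).ne'
    have hUK : lam (U \ K) < ENNReal.ofReal (ε / (‖c‖ + 1)) := by
      rw [← ENNReal.add_halves (ENNReal.ofReal (ε / (‖c‖ + 1)))]
      exact (measure_mono (fun x hx => (em (x ∈ s)).elim (fun h => Or.inr ⟨h, hx.2⟩)
        fun h => Or.inl ⟨hx.1, h⟩)).trans_lt
        ((measure_union_le _ _).trans_lt (ENNReal.add_lt_add hUl hKl))
    have hUKm : MeasurableSet (U \ K) := hU.measurableSet.diff hK.measurableSet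
    obtain ⟨χ, hχ1, hχ0, hχc, hχ⟩ := exists_continuous_one_zero_of_isCompact hK hU.isClosed_compl
      (disjoint_compl_right_iff_subset.2 (hKs.trans hsU))
    refine ⟨⟨⟨fun t => c * (χ t : ℂ), by fun_prop⟩,
      (hχc.comp_left (g := fun r : ℝ => (r : ℂ)) Complex.ofReal_zero).mul_left⟩, ?_⟩
    calc _ ≤ ∫ t, (U \ K).indicator (fun _ => ‖c‖) t ∂lam := by
          refine integral_mono_of_nonneg (Eventually.of_forall fun t => norm_nonneg _)
            ((integrable_indicator_iff hUKm).2 (integrableOn_const (hUK.trans_le le_top).ne))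
            (Eventually.of_forall fun t => ?_)
          change ‖s.indicator (fun _ => c) t - c * (χ t : ℂ)‖ ≤ _
          have h01 := hχ t
          by_cases hzK : t ∈ K
          · have : χ t = 1 := hχ1 hzK
            simp [hzK, hKs hzK, this]
          by_cases hzU : t ∈ U
          · rw [indicator_of_mem (show t ∈ U \ K from ⟨hzU, hzK⟩)]
            by_cases hzs : t ∈ s
            · have e : s.indicator (fun _ => c) t - c * (χ t : ℂ) = c * ((1 - χ t : ℝ) : ℂ) := by
                rw [indicator_of_mem hzs]; push_cast; ring
              rw [e, norm_mul, Complex.norm_real, Real.norm_of_nonneg (by linarith [h01.2])]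
              exact mul_le_of_le_one_right (norm_nonneg _) (by linarith [h01.1])
            · rw [indicator_of_notMem hzs, zero_sub, norm_neg, norm_mul, Complex.norm_real,
                Real.norm_of_nonneg h01.1]
              exact mul_le_of_le_one_right (norm_nonneg _) h01.2
          · have : χ t = 0 := hχ0 hzU
            simp [hzU, this, show t ∉ s from fun h => hzU (hsU h)]
      _ = lam.real (U \ K) * ‖c‖ := by rw [integral_indicator hUKm]; simp
      _ ≤ ε / (‖c‖ + 1) * (‖c‖ + 1) := by
          gcongr
          · exact ENNReal.toReal_le_of_le_ofReal (by positivity) hUK.le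
          · linarith
      _ = ε := by field_simp
  · intro f f' _ hf hf' h1 h2 ε hε
    obtain ⟨g, hg⟩ := h1 (ε / 2) (by positivity)
    obtain ⟨g', hg'⟩ := h2 (ε / 2) (by positivity)
    have hi := (hf.sub (integrable_cc g)).norm
    have hi' := (hf'.sub (integrable_cc g')).norm
    refine ⟨g + g', ?_⟩
    calc _ ≤ ∫ t, (‖f t - g t‖ + ‖f' t - g' t‖) ∂lam := by
          refine integral_mono_of_nonneg (Eventually.of_forall fun t => norm_nonneg _)
            (hi.add hi') (Eventually.of_forall fun t => ?_)
          have : (f + f') t - (g + g') t = (f t - g t) + (f' t - g' t) := by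
            simp only [Pi.add_apply, CompactlySupportedContinuousMap.add_apply]; ring
          change ‖(f + f') t - (g + g') t‖ ≤ _
          rw [this]
          exact norm_add_le _ _
      _ = (∫ t, ‖f t - g t‖ ∂lam) + ∫ t, ‖f' t - g' t‖ ∂lam := integral_add hi hi'
      _ ≤ ε := by linarith
  · refine isClosed_of_closure_subset fun f hf ε hε => ?_
    obtain ⟨f', hf', hd⟩ := Metric.mem_closure_iff.1 hf (ε / 2) (by positivity)
    obtain ⟨g, hg⟩ := hf' (ε / 2) (by positivity)
    refine ⟨g, ?_⟩
    rw [dist_eq_norm, norm_sub_eq_integral] at hd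
    have hi := ((L1.integrable_coeFn f).sub (L1.integrable_coeFn f')).norm
    have hi' := ((L1.integrable_coeFn f').sub (integrable_cc g)).norm
    calc _ ≤ ∫ t, (‖f t - f' t‖ + ‖f' t - g t‖) ∂lam := by
          refine integral_mono_of_nonneg (Eventually.of_forall fun t => norm_nonneg _)
            (hi.add hi') (Eventually.of_forall fun t => norm_sub_le_norm_sub_add_norm_sub _ _ _)
      _ = (∫ t, ‖f t - f' t‖ ∂lam) + ∫ t, ‖f' t - g t‖ ∂lam := integral_add hi hi'
      _ ≤ ε := by linarith
  · intro f f' hff' _ h1 ε hε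
    obtain ⟨g, hg⟩ := h1 ε hε
    refine ⟨g, le_trans (le_of_eq (integral_congr_ae ?_)) hg⟩
    filter_upwards [hff'] with t ht
    rw [ht]

theorem exists_norm_sub_ccToL1_le [lam.Regular] (c : Lp ℂ 1 lam) {ε : ℝ} (hε : 0 < ε) :
    ∃ g, ‖c - ccToL1 lam g‖ ≤ ε := by
  obtain ⟨g, hg⟩ := exists_integral_norm_sub_le (L1.integrable_coeFn c) ε hε
  refine ⟨g, le_trans (le_of_eq ?_) hg⟩
  rw [norm_sub_eq_integral]
  exact integral_congr_ae ((coeFn_ccToL1 g).mono fun t ht => by simp only [ht])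

theorem denseRange_ccToL1 [lam.Regular] : DenseRange (ccToL1 (H := H) lam) := fun c =>
  Metric.mem_closure_iff.2 fun ε hε => by
    obtain ⟨g, hg⟩ := exists_norm_sub_ccToL1_le c (half_pos hε)
    exact ⟨_, ⟨g, rfl⟩, by rw [dist_eq_norm]; linarith⟩

/-- The norm of `L¹` is computed by testing against continuous functions with compact support. -/
theorem norm_le_of_forall_norm_integral_le [lam.Regular] (c : Lp ℂ 1 lam) {B : ℝ}
    (hB : ∀ g : C_c(H, ℂ), (∀ t, ‖g t‖ ≤ 1) → ‖∫ t, c t * g t ∂lam‖ ≤ B) : ‖c‖ ≤ B := by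
  refine le_of_forall_pos_le_add fun ε hε => ?_
  obtain ⟨d, hd⟩ := exists_norm_sub_ccToL1_le c (ε := ε / 3) (by positivity)
  have hK : lam (tsupport d) < ∞ := d.hasCompactSupport.isCompact.measure_lt_top
  set m := lam.real (tsupport d) with hm
  have hm0 : 0 ≤ m := measureReal_nonneg
  set η := ε / (3 * (m + 1)) with hη
  have hη0 : 0 < η := by positivity
  -- the test function `g` is a continuous substitute for the conjugate of the sign of `d`
  have hgc : Continuous fun t => starRingEnd ℂ (d t) * ((‖d t‖ + η : ℝ) : ℂ)⁻¹ := by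
    refine (Complex.continuous_conj.comp d.continuous).mul (Continuous.inv₀ (by fun_prop) ?_)
    intro t
    have : 0 < ‖d t‖ + η := by positivity
    exact_mod_cast this.ne'
  let g : C_c(H, ℂ) := ⟨⟨_, hgc⟩, d.hasCompactSupport.mono fun t ht => by
    simp only [Function.mem_support] at ht ⊢
    intro h0
    exact ht (by simp [h0])⟩
  have hgt : ∀ t, g t = starRingEnd ℂ (d t) * ((‖d t‖ + η : ℝ) : ℂ)⁻¹ := fun t => rfl
  have hg1 : ∀ t, ‖g t‖ ≤ 1 := fun t => by
    have hp : 0 < ‖d t‖ + η := by positivity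
    rw [hgt, norm_mul, norm_inv, Complex.norm_real, Real.norm_of_nonneg hp.le, RCLike.norm_conj,
      ← div_eq_mul_inv, div_le_one hp]
    linarith
  have hdg : ∀ t, d t * g t = ((‖d t‖ ^ 2 / (‖d t‖ + η) : ℝ) : ℂ) := fun t => by
    rw [hgt, ← mul_assoc, Complex.mul_conj, Complex.normSq_eq_norm_sq]
    push_cast
    rw [div_eq_mul_inv]
  have hind : Integrable ((tsupport d).indicator fun _ => η) lam :=
    (integrable_indicator_iff (isClosed_tsupport d).measurableSet).2 (integrableOn_const hK.ne)
  have hdgi : Integrable (fun t => ‖d t‖ ^ 2 / (‖d t‖ + η)) lam := by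
    have := (integrable_mul_cc (integrable_cc (lam := lam) d) g).re
    refine this.congr (Eventually.of_forall fun t => ?_)
    simp only [hdg]
    exact Complex.ofReal_re _
  have h1 : ∫ t, ‖d t‖ ∂lam ≤ (∫ t, ‖d t‖ ^ 2 / (‖d t‖ + η) ∂lam) + m * η := by
    have : m * η = ∫ t, (tsupport d).indicator (fun _ => η) t ∂lam := by
      rw [integral_indicator (isClosed_tsupport d).measurableSet]
      simp [hm]
    rw [this, ← integral_add hdgi hind]
    refine integral_mono (integrable_cc d).norm (hdgi.add hind) fun t => ?_
    by_cases ht : t ∈ tsupport d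
    · have hp : 0 < ‖d t‖ + η := by positivity
      simp only [indicator_of_mem ht]
      rw [div_add' _ _ _ hp.ne', le_div_iff₀ hp]
      nlinarith [norm_nonneg (d t)]
    · simp [image_eq_zero_of_notMem_tsupport ht, ht]
  have h2 : ∫ t, ‖d t‖ ^ 2 / (‖d t‖ + η) ∂lam = ‖∫ t, d t * g t ∂lam‖ := by
    simp_rw [hdg]
    rw [integral_complex_ofReal, Complex.norm_real, Real.norm_of_nonneg]
    exact integral_nonneg fun t => by positivity
  have h3 : ‖∫ t, d t * g t ∂lam‖ ≤ B + ε / 3 := by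
    have e : ∫ t, d t * g t ∂lam =
        ∫ t, c t * g t ∂lam - ∫ t, (c - ccToL1 lam d : Lp ℂ 1 lam) t * g t ∂lam := by
      rw [← integral_ccToL1_mul, ← integral_sub (integrable_mul_cc (L1.integrable_coeFn c) g)
        (integrable_mul_cc (L1.integrable_coeFn _) g)]
      refine integral_congr_ae ?_
      filter_upwards [Lp.coeFn_sub c (ccToL1 lam d)] with t ht
      rw [ht, Pi.sub_apply]
      ring
    rw [e]
    refine (norm_sub_le _ _).trans (add_le_add (hB g hg1) ?_)
    exact (norm_integral_mul_coe_le _ hg1).trans (by rwa [one_mul])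
  have h4 : m * η ≤ ε / 3 := by
    calc m * η ≤ (m + 1) * η := by gcongr; linarith
      _ = ε / 3 := by rw [hη]; field_simp
  have h5 : ‖c‖ ≤ ‖c - ccToL1 lam d‖ + ‖ccToL1 lam d‖ := by
    simpa using norm_add_le (c - ccToL1 lam d) (ccToL1 lam d)
  rw [norm_ccToL1] at h5
  linarith

theorem toL1Dual_apply (f : H →ᵇ ℂ) (b : Lp ℂ 1 lam) :
    toL1Dual lam f b = ∫ t, b t * f t ∂lam := rfl

theorem leftTranslate_apply (x : H) (f : H →ᵇ ℂ) (t : H) :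
    leftTranslate x f t = evalConv f x t := rfl

theorem norm_leftTranslate_le (x : H) (f : H →ᵇ ℂ) : ‖leftTranslate x f‖ ≤ ‖f‖ :=
  BoundedContinuousFunction.norm_ofNormedAddCommGroup_le _ (norm_nonneg f) _

theorem norm_toL1Dual_le (f : H →ᵇ ℂ) : ‖toL1Dual lam f‖ ≤ ‖f‖ :=
  LinearMap.mkContinuous_norm_le _ (norm_nonneg f) _

theorem toL1Dual_ccToL1 [lam.Regular] (f : H →ᵇ ℂ) (b : C_c(H, ℂ)) :
    toL1Dual lam f (ccToL1 lam b) = ∫ t, b t * f t ∂lam := integral_ccToL1_mul b f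

/-- `toL1Dual` as a linear map. -/
noncomputable def toL1DualL (lam : Measure H) : (H →ᵇ ℂ) →L[ℂ] StrongDual ℂ (Lp ℂ 1 lam) :=
  LinearMap.mkContinuous
    { toFun := toL1Dual lam
      map_add' := fun f g => by
        ext b
        simp only [toL1Dual_apply, add_apply]
        rw [← integral_add
          (integrable_mul_of_bounded (L1.integrable_coeFn b) f.continuous f.norm_coe_le_norm)
          (integrable_mul_of_bounded (L1.integrable_coeFn b) g.continuous g.norm_coe_le_norm)]
        simp [mul_add]
      map_smul' := fun r f => by
        ext b
        simp only [toL1Dual_apply, RingHom.id_apply, smul_apply]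
        rw [smul_eq_mul, ← integral_const_mul]
        simp [mul_left_comm] } 1 fun f => by
      rw [one_mul]
      exact norm_toL1Dual_le f

theorem toL1DualL_apply (f : H →ᵇ ℂ) : toL1DualL lam f = toL1Dual lam f := rfl

/-- For `b ∈ L¹(H)` and `f ∈ C_b(H)`, the function `x ↦ ∫ b(y) f(x * y) dlam(y)`. -/
noncomputable def orbitFun [lam.Regular] (f : H →ᵇ ℂ) (b : Lp ℂ 1 lam) : H →ᵇ ℂ :=
  BoundedContinuousFunction.ofNormedAddCommGroup
    (fun x => toL1Dual lam (leftTranslate x f) b)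
    (continuous_integral_mul (G := evalConv f) (continuous_evalConv f)
      (norm_evalConv_le f) (L1.integrable_coeFn b)) (‖f‖ * ‖b‖)
    (fun x => norm_integral_mul_coe_le b (norm_evalConv_le f x))

theorem orbitFun_apply [lam.Regular] (f : H →ᵇ ℂ) (b : Lp ℂ 1 lam) (x : H) :
    orbitFun f b x = toL1Dual lam (leftTranslate x f) b := rfl

theorem norm_orbitFun_le [lam.Regular] (f : H →ᵇ ℂ) (b : Lp ℂ 1 lam) :
    ‖orbitFun f b‖ ≤ ‖f‖ * ‖b‖ :=
  BoundedContinuousFunction.norm_ofNormedAddCommGroup_le _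
    (mul_nonneg (norm_nonneg f) (norm_nonneg b)) _

/-- `orbitFun` as a linear map in the second variable. -/
noncomputable def orbitFunL [lam.Regular] (f : H →ᵇ ℂ) : Lp ℂ 1 lam →L[ℂ] (H →ᵇ ℂ) :=
  LinearMap.mkContinuous
    { toFun := orbitFun f
      map_add' := fun b b' => by
        ext x
        exact map_add (toL1Dual lam (leftTranslate x f)) b b'
      map_smul' := fun r b => by
        ext x
        exact map_smul (toL1Dual lam (leftTranslate x f)) r b } ‖f‖ (norm_orbitFun_le f)

theorem orbitFunL_apply [lam.Regular] (f : H →ᵇ ℂ) (b : Lp ℂ 1 lam) :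
    orbitFunL f b = orbitFun f b := rfl

theorem isL1Conv_iff [lam.Regular] {a b c : Lp ℂ 1 lam} :
    IsL1Conv lam a b c ↔ ∀ g : C_c(H, ℂ),
      toL1Dual lam (g : H →ᵇ ℂ) c = toL1Dual lam (orbitFun (g : H →ᵇ ℂ) b) a := Iff.rfl

theorem l1Conv_add_left (h : IsLeftHaar lam) (a a' b : Lp ℂ 1 lam) :
    l1Conv h (a + a') b = l1Conv h a b + l1Conv h a' b := by
  have := h.regular
  refine (isL1Conv_l1Conv h _ _).unique h (isL1Conv_iff.2 fun g => ?_)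
  rw [map_add, map_add, isL1Conv_iff.1 (isL1Conv_l1Conv h _ _) g,
    isL1Conv_iff.1 (isL1Conv_l1Conv h _ _) g]

theorem l1Conv_smul_left (h : IsLeftHaar lam) (r : ℂ) (a b : Lp ℂ 1 lam) :
    l1Conv h (r • a) b = r • l1Conv h a b := by
  have := h.regular
  refine (isL1Conv_l1Conv h _ _).unique h (isL1Conv_iff.2 fun g => ?_)
  rw [map_smul, map_smul, isL1Conv_iff.1 (isL1Conv_l1Conv h _ _) g]

theorem l1Conv_add_right (h : IsLeftHaar lam) (a b b' : Lp ℂ 1 lam) :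
    l1Conv h a (b + b') = l1Conv h a b + l1Conv h a b' := by
  have := h.regular
  refine (isL1Conv_l1Conv h _ _).unique h (isL1Conv_iff.2 fun g => ?_)
  rw [map_add, isL1Conv_iff.1 (isL1Conv_l1Conv h _ _) g,
    isL1Conv_iff.1 (isL1Conv_l1Conv h _ _) g]
  simp only [← toL1DualL_apply, ← orbitFunL_apply, map_add, add_apply]

theorem l1Conv_smul_right (h : IsLeftHaar lam) (r : ℂ) (a b : Lp ℂ 1 lam) :
    l1Conv h a (r • b) = r • l1Conv h a b := by
  have := h.regular
  refine (isL1Conv_l1Conv h _ _).unique h (isL1Conv_iff.2 fun g => ?_)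
  rw [map_smul, isL1Conv_iff.1 (isL1Conv_l1Conv h _ _) g]
  simp only [← toL1DualL_apply, ← orbitFunL_apply, map_smul, smul_apply]

theorem norm_l1Conv_le (h : IsLeftHaar lam) (a b : Lp ℂ 1 lam) :
    ‖l1Conv h a b‖ ≤ ‖a‖ * ‖b‖ := by
  have := h.regular
  refine norm_le_of_forall_norm_integral_le _ fun g hg => ?_
  have hg' : ‖(g : H →ᵇ ℂ)‖ ≤ 1 := (BoundedContinuousFunction.norm_le zero_le_one).2 hg
  have e := isL1Conv_iff.1 (isL1Conv_l1Conv h a b) g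
  change ‖toL1Dual lam (g : H →ᵇ ℂ) (l1Conv h a b)‖ ≤ _
  rw [e]
  refine (ContinuousLinearMap.le_opNorm _ _).trans ?_
  rw [mul_comm]
  refine mul_le_mul_of_nonneg_left ?_ (norm_nonneg a)
  refine (norm_toL1Dual_le _).trans ((norm_orbitFun_le _ _).trans ?_)
  exact mul_le_of_le_one_left (norm_nonneg b) hg'

/-- The convolution of `L¹(H)` as a bounded bilinear map. -/
noncomputable def l1ConvL (h : IsLeftHaar lam) : Lp ℂ 1 lam →L[ℂ] Lp ℂ 1 lam →L[ℂ] Lp ℂ 1 lam :=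
  LinearMap.mkContinuous₂
    (LinearMap.mk₂ ℂ (l1Conv h) (l1Conv_add_left h) (l1Conv_smul_left h) (l1Conv_add_right h)
      (l1Conv_smul_right h)) 1 fun a b => by
    rw [one_mul]; exact norm_l1Conv_le h a b

theorem l1ConvL_apply (h : IsLeftHaar lam) (a b : Lp ℂ 1 lam) :
    l1ConvL h a b = l1Conv h a b := rfl

/-- The formula `∫ (a * b) f dlam = ∫∫ a(x) b(y) f(x * y)`, which defines `a * b` through the
`f ∈ C_c(H)`, holds for all `f ∈ C_b(H)`. -/
theorem toL1Dual_l1Conv [lam.Regular] (h : IsLeftHaar lam) (f : H →ᵇ ℂ) (a b : Lp ℂ 1 lam) :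
    toL1Dual lam f (l1Conv h a b) = toL1Dual lam (orbitFun f b) a := by
  -- by density, `a` and `b` may be taken continuous with compact support
  suffices hcc : ∀ a b : C_c(H, ℂ), toL1Dual lam f (l1Conv h (ccToL1 lam a) (ccToL1 lam b)) =
      toL1Dual lam (orbitFun f (ccToL1 lam b)) (ccToL1 lam a) by
    have h1 : ∀ a : C_c(H, ℂ), ∀ b, toL1Dual lam f (l1Conv h (ccToL1 lam a) b) =
        toL1Dual lam (orbitFun f b) (ccToL1 lam a) := fun a b =>
      congrFun (denseRange_ccToL1.equalizer
        (g := fun b => toL1Dual lam f (l1ConvL h (ccToL1 lam a) b))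
        (h := fun b => toL1DualL lam (orbitFunL f b) (ccToL1 lam a)) (by fun_prop) (by fun_prop)
        (funext fun b => hcc a b)) b
    exact congrFun (denseRange_ccToL1.equalizer
        (g := fun a => toL1Dual lam f ((l1ConvL h).flip b a))
        (h := fun a => toL1Dual lam (orbitFun f b) a) (by fun_prop) (by fun_prop)
        (funext fun a => h1 a b)) a
  intro a b
  set c := l1Conv h (ccToL1 lam a) (ccToL1 lam b) with hc
  obtain ⟨L, hL, hLab⟩ := exists_isCompact_supp_subset
    (a.hasCompactSupport.isCompact.prod b.hasCompactSupport.isCompact)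
  rw [← sub_eq_zero, ← norm_le_zero_iff]
  refine le_of_forall_pos_le_add fun ε hε => ?_
  obtain ⟨d, hd⟩ := exists_norm_sub_ccToL1_le c (ε := ε / (2 * ‖f‖ + 1)) (by positivity)
  obtain ⟨χ, hχ1, hχle⟩ := exists_cutoff (hL.union d.hasCompactSupport.isCompact)
  let g : C_c(H, ℂ) := ⟨⟨fun t => χ t * f t, χ.continuous.mul f.continuous⟩,
    χ.hasCompactSupport.mul_right⟩
  have hgt : ∀ t, g t = χ t * f t := fun t => rfl
  have e1 : toL1Dual lam (orbitFun f (ccToL1 lam b)) (ccToL1 lam a) =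
      toL1Dual lam (g : H →ᵇ ℂ) c := by
    rw [hc, isL1Conv_iff.1 (isL1Conv_l1Conv h _ _) g, toL1Dual_ccToL1, toL1Dual_ccToL1]
    refine integral_congr_ae (Eventually.of_forall fun x => ?_)
    by_cases hx : x ∈ tsupport a
    · simp only [orbitFun_apply, toL1Dual_ccToL1]
      congr 1
      refine integral_congr_ae (Eventually.of_forall fun y => ?_)
      by_cases hy : y ∈ tsupport b
      · simp only [leftTranslate_apply]
        congr 1
        refine evalConv_congr fun t ht => ?_
        change f t = χ t * f t
        rw [hχ1 t (Or.inl (hLab (x, y) ⟨hx, hy⟩ ht)), one_mul]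
      · simp [image_eq_zero_of_notMem_tsupport hy]
    · simp [image_eq_zero_of_notMem_tsupport hx]
  have e2 : toL1Dual lam f c - toL1Dual lam (g : H →ᵇ ℂ) c =
      toL1Dual lam (f - (g : H →ᵇ ℂ)) (c - ccToL1 lam d) := by
    have h0 : toL1Dual lam (f - (g : H →ᵇ ℂ)) (ccToL1 lam d) = 0 := by
      rw [toL1Dual_ccToL1]
      refine integral_eq_zero_of_ae (Eventually.of_forall fun t => ?_)
      by_cases ht : t ∈ tsupport d
      · change d t * (f t - χ t * f t) = 0
        rw [hχ1 t (Or.inr ht)]; ring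
      · simp [image_eq_zero_of_notMem_tsupport ht]
    rw [map_sub, h0, sub_zero, ← toL1DualL_apply, ← toL1DualL_apply, ← toL1DualL_apply, map_sub]
    rfl
  have hfg : ‖f - (g : H →ᵇ ℂ)‖ ≤ 2 * ‖f‖ := by
    refine (norm_sub_le _ _).trans ?_
    have : ‖(g : H →ᵇ ℂ)‖ ≤ ‖f‖ := (BoundedContinuousFunction.norm_le (norm_nonneg f)).2 fun t => by
      change ‖χ t * f t‖ ≤ ‖f‖
      rw [norm_mul]
      exact (mul_le_of_le_one_left (norm_nonneg _) (hχle t)).trans (f.norm_coe_le_norm t)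
    linarith
  rw [e1, e2, zero_add]
  refine (ContinuousLinearMap.le_opNorm _ _).trans ?_
  calc _ ≤ (2 * ‖f‖) * (ε / (2 * ‖f‖ + 1)) := by
        gcongr
        exact (norm_toL1Dual_le _).trans hfg
    _ ≤ (2 * ‖f‖ + 1) * (ε / (2 * ‖f‖ + 1)) := by gcongr; linarith
    _ = ε := by field_simp

/-! ### Translation in `L¹(H)` and the approximate identity -/

theorem exists_mem_of_evalConv_invol_ne_zero {𝕜 : Type*} [RCLike 𝕜] {f : H → 𝕜} {x z : H}
    (h : evalConv f (invol x) z ≠ 0) : ∃ t, f t ≠ 0 ∧ z ∈ supp x t := by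
  obtain ⟨t, ht, hft⟩ := exists_mem_supp_of_evalConv_ne_zero h
  exact ⟨t, hft, by simpa [invol_invol] using mem_supp_invol_left ht⟩

/-- The translate `z ↦ b(x̌ * z)`, which is the density of `δ_x * (b·lam)`. -/
noncomputable def translate (b : C_c(H, ℂ)) (x : H) : C_c(H, ℂ) where
  toFun z := evalConv b (invol x) z
  continuous_toFun := continuous_evalConv_left b (invol x)
  hasCompactSupport' := by
    obtain ⟨L, hL, h⟩ := exists_isCompact_supp_subset
      ((isCompact_singleton (x := x)).prod b.hasCompactSupport.isCompact)
    refine HasCompactSupport.intro hL fun z hz => ?_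
    by_contra hne
    obtain ⟨t, ht, hzt⟩ := exists_mem_of_evalConv_invol_ne_zero hne
    exact hz (h (x, t) ⟨rfl, subset_tsupport _ ht⟩ hzt)

theorem toL1Dual_translate [lam.Regular] (h : IsLeftHaar lam) (b g : C_c(H, ℂ)) (x : H) :
    toL1Dual lam (g : H →ᵇ ℂ) (ccToL1 lam (translate b x)) =
      orbitFun (g : H →ᵇ ℂ) (ccToL1 lam b) x := by
  rw [orbitFun_apply, toL1Dual_ccToL1, toL1Dual_ccToL1]
  refine Eq.trans ?_ (integral_mul_evalConv_comm h g b x).symm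
  exact integral_congr_ae (Eventually.of_forall fun z => mul_comm _ _)

theorem norm_ccToL1_translate_le [lam.Regular] (h : IsLeftHaar lam) (b : C_c(H, ℂ)) (x : H) :
    ‖ccToL1 lam (translate b x)‖ ≤ ‖ccToL1 lam b‖ := by
  refine norm_le_of_forall_norm_integral_le _ fun g hg => ?_
  change ‖toL1Dual lam (g : H →ᵇ ℂ) (ccToL1 lam (translate b x))‖ ≤ _
  rw [toL1Dual_translate h]
  refine (BoundedContinuousFunction.norm_coe_le_norm _ x).trans ((norm_orbitFun_le _ _).trans ?_)
  exact mul_le_of_le_one_left (norm_nonneg _)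
    ((BoundedContinuousFunction.norm_le zero_le_one).2 hg)

/-- Left translation in `L¹(H)` is norm continuous on `C_c(H)`. -/
theorem continuous_ccToL1_translate [lam.Regular] (b : C_c(H, ℂ)) :
    Continuous fun x => ccToL1 lam (translate b x) := by
  refine Metric.continuous_iff'.2 fun x ε hε => ?_
  obtain ⟨N, hN, hxN⟩ := exists_compact_mem_nhds x
  obtain ⟨L, hL, hLN⟩ := exists_isCompact_supp_subset (hN.prod b.hasCompactSupport.isCompact)
  have hz : ∀ x ∈ N, ∀ z ∉ L, translate b x z = 0 := fun x hx z hz => by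
    by_contra hne
    obtain ⟨t, ht, hzt⟩ := exists_mem_of_evalConv_invol_ne_zero hne
    exact hz (hLN (x, t) ⟨hx, subset_tsupport _ ht⟩ hzt)
  set m := lam.real L
  have hm : 0 ≤ m := measureReal_nonneg
  set δ := ε / (2 * (m + 1)) with hδ
  have hδ0 : 0 < δ := by positivity
  have hnear : ∀ᶠ x' in 𝓝 x, ∀ z ∈ L, dist (translate b x' z) (translate b x z) < δ := by
    refine hL.eventually_forall_of_forall_eventually fun z _ => ?_
    have hc : Continuous fun p : H × H => dist (translate b p.1 p.2) (translate b x p.2) :=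
      ((continuous_uncurry_evalConv b).comp
        ((continuous_invol.comp continuous_fst).prodMk continuous_snd)).dist
        ((translate b x).continuous.comp continuous_snd)
    exact hc.continuousAt.eventually (gt_mem_nhds (by simpa using hδ0))
  filter_upwards [hnear, hxN] with x' hx' hx'N
  have hind : Integrable (L.indicator fun _ => δ) lam :=
    (integrable_indicator_iff hL.measurableSet).2 (integrableOn_const hL.measure_lt_top.ne)
  rw [dist_eq_norm, norm_sub_eq_integral]
  calc _ = ∫ z, ‖translate b x' z - translate b x z‖ ∂lam := by
        refine integral_congr_ae ?_
        filter_upwards [coeFn_ccToL1 (lam := lam) (translate b x'),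
          coeFn_ccToL1 (lam := lam) (translate b x)] with z h1 h2
        rw [h1, h2]
    _ ≤ ∫ z, L.indicator (fun _ => δ) z ∂lam := by
        refine integral_mono_of_nonneg (Eventually.of_forall fun z => norm_nonneg _) hind
          (Eventually.of_forall fun z => ?_)
        by_cases hzL : z ∈ L
        · simp only [indicator_of_mem hzL]
          rw [← dist_eq_norm]
          exact (hx' z hzL).le
        · simp [hz x' hx'N z hzL, hz x (mem_of_mem_nhds hxN) z hzL, hzL]
    _ = m * δ := by rw [integral_indicator hL.measurableSet]; simp [m]
    _ ≤ (m + 1) * δ := by gcongr; linarith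
    _ = ε / 2 := by rw [hδ]; field_simp
    _ < ε := by linarith

/-- For `φ ∈ L¹(H)*` and `b ∈ C_c(H)`, the function `x ↦ φ(δ_x * b)`. -/
noncomputable def dualOrbitFun [lam.Regular] (h : IsLeftHaar lam) (φ : StrongDual ℂ (Lp ℂ 1 lam))
    (b : C_c(H, ℂ)) : H →ᵇ ℂ :=
  BoundedContinuousFunction.ofNormedAddCommGroup (fun x => φ (ccToL1 lam (translate b x)))
    (φ.continuous.comp (continuous_ccToL1_translate b)) (‖φ‖ * ‖ccToL1 lam b‖)
    fun x => (φ.le_opNorm _).trans (by gcongr; exact norm_ccToL1_translate_le h b x)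

/-- For `b ∈ C_c(H)`, the functional `a ↦ φ(a * b)` is given by a bounded continuous function,
because `a * b` is the vector-valued integral `∫ a(x) (δ_x * b) dlam(x)`. -/
theorem apply_l1Conv_ccToL1 [lam.Regular] (h : IsLeftHaar lam) (φ : StrongDual ℂ (Lp ℂ 1 lam))
    (a : Lp ℂ 1 lam) (b : C_c(H, ℂ)) :
    φ (l1Conv h a (ccToL1 lam b)) = toL1Dual lam (dualOrbitFun h φ b) a := by
  suffices hcc : ∀ a : C_c(H, ℂ), φ (l1Conv h (ccToL1 lam a) (ccToL1 lam b)) =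
      toL1Dual lam (dualOrbitFun h φ b) (ccToL1 lam a) from
    congrFun (denseRange_ccToL1.equalizer (g := fun a => φ ((l1ConvL h).flip (ccToL1 lam b) a))
        (h := fun a => toL1Dual lam (dualOrbitFun h φ b) a) (by fun_prop) (by fun_prop)
        (funext hcc)) a
  intro a
  set v : H → Lp ℂ 1 lam := fun x => a x • ccToL1 lam (translate b x) with hv
  have hvi : Integrable v lam :=
    (a.continuous.smul (continuous_ccToL1_translate b)).integrable_of_hasCompactSupport
      a.hasCompactSupport.smul_right
  have hconv : l1Conv h (ccToL1 lam a) (ccToL1 lam b) = ∫ x, v x ∂lam := by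
    refine (isL1Conv_l1Conv h _ _).unique h (isL1Conv_iff.2 fun g => ?_)
    rw [← ContinuousLinearMap.integral_comp_comm _ hvi, toL1Dual_ccToL1]
    simp only [hv, map_smul, smul_eq_mul, toL1Dual_translate h]
  rw [hconv, ← ContinuousLinearMap.integral_comp_comm _ hvi, toL1Dual_ccToL1]
  simp only [hv, map_smul, smul_eq_mul]
  rfl

/-- A real function with compact support as a complex one. -/
def ccOfReal (k : C_c(H, ℝ)) : C_c(H, ℂ) :=
  ⟨⟨fun t => (k t : ℂ), Complex.continuous_ofReal.comp k.continuous⟩,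
    k.hasCompactSupport.comp_left (g := fun r : ℝ => (r : ℂ)) Complex.ofReal_zero⟩

theorem ccOfReal_apply (k : C_c(H, ℝ)) (t : H) : ccOfReal k t = (k t : ℂ) := rfl

theorem IsBump.norm_ccToL1 [lam.Regular] {V : Set H} {k : C_c(H, ℝ)} (hk : IsBump lam V k) :
    ‖ccToL1 lam (ccOfReal k)‖ = 1 := by
  rw [LCHypergroup.norm_ccToL1, ← hk.integral_eq_one]
  refine integral_congr_ae (Eventually.of_forall fun t => ?_)
  simp only [ccOfReal_apply, Complex.norm_real]
  exact Real.norm_of_nonneg (hk.nonneg t)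

/-- The convolution with a symmetric function `k` is `smear lam k`. -/
theorem toL1Dual_l1Conv_bump [lam.Regular] (h : IsLeftHaar lam) (a g : C_c(H, ℂ)) {k : C_c(H, ℝ)}
    (hk : ∀ t, k (invol t) = k t) :
    toL1Dual lam (g : H →ᵇ ℂ) (l1Conv h (ccToL1 lam a) (ccToL1 lam (ccOfReal k))) =
      ∫ s, g s * smear lam k a s ∂lam := by
  rw [isL1Conv_iff.1 (isL1Conv_l1Conv h _ _) g, toL1Dual_ccToL1]
  have e1 : ∀ x, orbitFun (g : H →ᵇ ℂ) (ccToL1 lam (ccOfReal k)) x =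
      ∫ s, g s * ((evalConv k (invol s) x : ℝ) : ℂ) ∂lam := fun x => by
    rw [orbitFun_apply, toL1Dual_ccToL1]
    refine (integral_mul_evalConv_comm h g (ccOfReal k) x).trans ?_
    refine integral_congr_ae (Eventually.of_forall fun s => ?_)
    simp only
    rw [evalConv_invol_comm hk, ← evalConv_ofReal]
    rfl
  simp_rw [e1, smear, ← integral_const_mul]
  have hkc := continuous_uncurry_evalConv (H := H) k
  have hsw := integral_integral_swap_of_hasCompactSupport (μ := lam) (ν := lam)
    (f := fun x s => a x * (g s * ((evalConv k (invol s) x : ℝ) : ℂ)))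
    ((a.continuous.comp continuous_fst).mul ((g.continuous.comp continuous_snd).mul
      (Complex.continuous_ofReal.comp
        (hkc.comp ((continuous_invol.comp continuous_snd).prodMk continuous_fst)))))
    (HasCompactSupport.intro (a.hasCompactSupport.prod g.hasCompactSupport) fun p hp => by
      by_cases h1 : p.1 ∈ tsupport a
      · have : p.2 ∉ tsupport g := fun h2 => hp ⟨h1, h2⟩
        simp [Function.uncurry, image_eq_zero_of_notMem_tsupport this]
      · simp [Function.uncurry, image_eq_zero_of_notMem_tsupport h1])
  rw [hsw]
  simp only [mul_left_comm]

theorem exists_nhds_norm_l1Conv_ccToL1_sub_le [lam.Regular] (h : IsLeftHaar lam) (a : C_c(H, ℂ))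
    {ε : ℝ} (hε : 0 < ε) :
    ∃ V ∈ 𝓝 (e : H), ∀ k, IsBump lam V k → (∀ t, k (invol t) = k t) →
      ‖l1Conv h (ccToL1 lam a) (ccToL1 lam (ccOfReal k)) - ccToL1 lam a‖ ≤ ε := by
  obtain ⟨V₀, hV₀, hV₀e⟩ := exists_compact_mem_nhds (e : H)
  obtain ⟨L, hL, hLa⟩ := exists_isCompact_supp_subset
    (a.hasCompactSupport.isCompact.prod (hV₀.image continuous_invol))
  set K := L ∪ tsupport a with hK
  have hKc : IsCompact K := hL.union a.hasCompactSupport.isCompact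
  set m := lam.real K
  have hm : 0 ≤ m := measureReal_nonneg
  set δ := ε / (m + 1) with hδ
  have hδ0 : 0 < δ := by positivity
  obtain ⟨V, hV, hVk⟩ := exists_nhds_norm_smear_sub_le h a hKc hδ0
  refine ⟨V ∩ V₀, inter_mem hV hV₀e, fun k hk hks => ?_⟩
  have hzero : ∀ s ∉ K, smear lam k a s = 0 := fun s hs => by
    refine integral_eq_zero_of_ae (Eventually.of_forall fun x => ?_)
    by_cases hx : x ∈ tsupport a
    · have : evalConv k (invol s) x = 0 := by
        by_contra hne
        obtain ⟨v, hv, hxv⟩ := exists_mem_of_evalConv_invol_ne_zero hne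
        exact hs (Or.inl (hLa (x, invol v) ⟨hx, mem_image_of_mem _ (hk.mem_of_ne_zero v hv).2⟩
          (mem_supp_invol_right hxv)))
      simp [this]
    · simp [image_eq_zero_of_notMem_tsupport hx]
  refine norm_le_of_forall_norm_integral_le _ fun g hg => ?_
  change ‖toL1Dual lam (g : H →ᵇ ℂ) (_ - ccToL1 lam a)‖ ≤ ε
  have hind : Integrable (K.indicator fun _ => δ) lam :=
    (integrable_indicator_iff hKc.measurableSet).2 (integrableOn_const hKc.measure_lt_top.ne)
  have hai := integrable_cc (lam := lam) a
  obtain ⟨M, hM⟩ := exists_bound_smear k hai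
  have hi1 : Integrable (fun s => g s * smear lam k a s) lam :=
    integrable_mul_of_bounded (integrable_cc g) (continuous_smear k hai) hM
  have hi2 : Integrable (fun s => g s * a s) lam := integrable_mul_cc (integrable_cc g) a
  have e2 : toL1Dual lam (g : H →ᵇ ℂ) (ccToL1 lam a) = ∫ s, g s * a s ∂lam := by
    rw [toL1Dual_ccToL1]
    exact integral_congr_ae (Eventually.of_forall fun s => mul_comm _ _)
  rw [map_sub, toL1Dual_l1Conv_bump h a g hks, e2, ← integral_sub hi1 hi2]
  calc _ ≤ ∫ s, K.indicator (fun _ => δ) s ∂lam := by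
        refine norm_integral_le_of_norm_le hind (Eventually.of_forall fun s => ?_)
        rw [← mul_sub, norm_mul]
        by_cases hs : s ∈ K
        · rw [indicator_of_mem hs]
          exact (mul_le_of_le_one_left (norm_nonneg _) (hg s)).trans
            (hVk k (hk.mono inter_subset_left) s hs)
        · have : a s = 0 := image_eq_zero_of_notMem_tsupport fun h => hs (Or.inr h)
          simp [hzero s hs, this, hs]
    _ = m * δ := by rw [integral_indicator hKc.measurableSet]; simp [m]
    _ ≤ (m + 1) * δ := by gcongr; linarith
    _ = ε := by rw [hδ]; field_simp

/-- The symmetric bump functions at `e` form a right approximate identity of `L¹(H)`. -/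
theorem exists_nhds_norm_l1Conv_sub_le [lam.Regular] (h : IsLeftHaar lam) (a : Lp ℂ 1 lam)
    {ε : ℝ} (hε : 0 < ε) :
    ∃ V ∈ 𝓝 (e : H), ∀ k, IsBump lam V k → (∀ t, k (invol t) = k t) →
      ‖l1Conv h a (ccToL1 lam (ccOfReal k)) - a‖ ≤ ε := by
  obtain ⟨d, hd⟩ := exists_norm_sub_ccToL1_le a (ε := ε / 3) (by positivity)
  obtain ⟨V, hV, hVk⟩ := exists_nhds_norm_l1Conv_ccToL1_sub_le h d (ε := ε / 3) (by positivity)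
  refine ⟨V, hV, fun k hk hks => ?_⟩
  set κ := ccToL1 lam (ccOfReal k) with hκ
  have e1 : l1Conv h a κ - a = l1Conv h (a - ccToL1 lam d) κ +
      (l1Conv h (ccToL1 lam d) κ - ccToL1 lam d) - (a - ccToL1 lam d) := by
    simp only [← l1ConvL_apply, map_sub, sub_apply]
    abel
  have h1 : ‖l1Conv h (a - ccToL1 lam d) κ‖ ≤ ε / 3 := by
    refine (norm_l1Conv_le h _ _).trans ?_
    rw [hκ, hk.norm_ccToL1, mul_one]
    exact hd
  have h2 := hVk k hk hks
  rw [e1]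
  refine (norm_sub_le _ _).trans ((add_le_add (norm_add_le _ _) le_rfl).trans ?_)
  linarith

/-! ### The embedding of `C_b(H)` into the dual of `L¹(H)` -/

variable (lam) in
/-- The filter generated by the sets of bump functions of mass one that vanish off a given
neighbourhood of `x`. -/
def bumpFilter (x : H) : Filter C_c(H, ℝ) := (𝓝 x).lift' fun V => {k | IsBump lam V k}

theorem monotone_setOf_isBump : Monotone fun V : Set H => {k | IsBump lam V k} :=
  fun _ _ hVW _ hk => IsBump.mono hk hVW

theorem bumpFilter_neBot (h : IsLeftHaar lam) (x : H) : (bumpFilter lam x).NeBot :=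
  (lift'_neBot_iff monotone_setOf_isBump).2 fun _ hV => exists_isBump h hV

theorem eventually_isBump {x : H} {V : Set H} (hV : V ∈ 𝓝 x) :
    ∀ᶠ k in bumpFilter lam x, IsBump lam V k :=
  mem_lift' (h := fun V => {k | IsBump lam V k}) hV

theorem bumpFilter_inf_symm_neBot (h : IsLeftHaar lam) :
    (bumpFilter lam (e : H) ⊓ 𝓟 {k | ∀ t, k (invol t) = k t}).NeBot := by
  refine inf_principal_neBot_iff.2 fun U hU => ?_
  obtain ⟨V, hV, hVU⟩ := (mem_lift'_sets monotone_setOf_isBump).1 hU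
  obtain ⟨k, hk, hks⟩ := exists_isBump_symm h hV
  exact ⟨k, hVU hk, hks⟩

theorem tendsto_toL1Dual_bump [lam.Regular] (G : H →ᵇ ℂ) (x : H) :
    Tendsto (fun k => toL1Dual lam G (ccToL1 lam (ccOfReal k))) (bumpFilter lam x)
      (𝓝 (G x)) := by
  refine Metric.tendsto_nhds.2 fun ε hε => ?_
  filter_upwards [eventually_isBump (Metric.continuousAt_iff'.1 G.continuous.continuousAt (ε / 2)
    (half_pos hε))] with k hk
  have hki : Integrable (fun t => (k t : ℂ)) lam := integrable_cc (ccOfReal k)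
  have hkr : Integrable k lam := k.continuous.integrable_of_hasCompactSupport k.hasCompactSupport
  have hGx : G x = ∫ t, (k t : ℂ) * G x ∂lam := by
    rw [integral_mul_const, integral_complex_ofReal, hk.integral_eq_one]
    simp
  rw [dist_eq_norm, toL1Dual_ccToL1]
  conv_lhs => rw [hGx]
  simp only [ccOfReal_apply]
  rw [← integral_sub (integrable_mul_of_bounded hki G.continuous G.norm_coe_le_norm)
    (hki.mul_const _)]
  calc _ ≤ ∫ t, k t * (ε / 2) ∂lam := by
        refine norm_integral_le_of_norm_le (hkr.mul_const _) (Eventually.of_forall fun t => ?_)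
        rw [← mul_sub, norm_mul, Complex.norm_real, Real.norm_of_nonneg (hk.nonneg t)]
        by_cases ht : k t = 0
        · simp [ht]
        · refine mul_le_mul_of_nonneg_left ?_ (hk.nonneg t)
          rw [← dist_eq_norm]
          exact (show dist (G t) (G x) < ε / 2 from hk.mem_of_ne_zero t ht).le
    _ = ε / 2 := by rw [integral_mul_const, hk.integral_eq_one, one_mul]
    _ < ε := half_lt_self hε

theorem norm_toL1Dual (h : IsLeftHaar lam) (f : H →ᵇ ℂ) : ‖toL1Dual lam f‖ = ‖f‖ := by
  have := h.regular
  refine le_antisymm (norm_toL1Dual_le f)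
    ((BoundedContinuousFunction.norm_le (norm_nonneg _)).2 fun x => ?_)
  have := bumpFilter_neBot h x
  refine le_of_tendsto (tendsto_toL1Dual_bump (lam := lam) f x).norm ?_
  filter_upwards [eventually_isBump univ_mem] with k hk
  refine ((toL1Dual lam f).le_opNorm _).trans (le_of_eq ?_)
  rw [hk.norm_ccToL1, mul_one]

/-- The isometric embedding of `C_b(H)` into `L¹(H)*`. -/
noncomputable def toL1DualLI (h : IsLeftHaar lam) :
    (H →ᵇ ℂ) →ₗᵢ[ℂ] StrongDual ℂ (Lp ℂ 1 lam) :=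
  ⟨(toL1DualL lam).toLinearMap, norm_toL1Dual h⟩

theorem coe_toL1DualLI (h : IsLeftHaar lam) : ⇑(toL1DualLI h) = toL1Dual lam := rfl

/-! ### Weakly almost periodic functionals -/

theorem comp_l1ConvL_mem_l1Orbit (h : IsLeftHaar lam) (φ : StrongDual ℂ (Lp ℂ 1 lam))
    {a : Lp ℂ 1 lam} (ha : ‖a‖ ≤ 1) : φ.comp (l1ConvL h a) ∈ l1Orbit h φ :=
  ⟨a, ha, fun _ => rfl⟩

theorem isBounded_l1Orbit (h : IsLeftHaar lam) (φ : StrongDual ℂ (Lp ℂ 1 lam)) :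
    Bornology.IsBounded (l1Orbit h φ) := by
  refine (Metric.isBounded_closedBall (x := 0) (r := ‖φ‖)).subset fun ψ hψ => ?_
  obtain ⟨a, ha, hψ⟩ := hψ
  refine mem_closedBall_zero_iff.2 (ψ.opNorm_le_bound (norm_nonneg φ) fun b => ?_)
  rw [hψ]
  refine (φ.le_opNorm _).trans ?_
  gcongr
  exact (norm_l1Conv_le h a b).trans (mul_le_of_le_one_left (norm_nonneg b) ha)

theorem toL1Dual_mem_WAP (h : IsLeftHaar lam) {f : H →ᵇ ℂ} (hf : f ∈ wap H) :
    toL1Dual lam f ∈ WAP h := by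
  have := h.regular
  set A : H → StrongDual ℂ (Lp ℂ 1 lam) := fun x => toL1Dual lam (leftTranslate x f) with hA
  have hrel : IsRelWeaklyCompact (range A) := by
    have := IsRelWeaklyCompact.image hf (toL1DualL lam)
    rwa [← range_comp] at this
  have hAc : ∀ y : StrongDual ℂ (StrongDual ℂ (Lp ℂ 1 lam)), Continuous fun x => y (A x) :=
    hrel.continuous_of_continuous_eval fun b => (orbitFun f b).continuous
  have hAn : ∀ x, ‖A x‖ ≤ ‖f‖ := fun x => (norm_toL1Dual_le _).trans (norm_leftTranslate_le x f)
  have hnorm : ∀ {a : Lp ℂ 1 lam}, ‖a‖ ≤ 1 → ∫ x, ‖a x‖ ∂lam ≤ 1 := fun ha => by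
    rwa [← L1.norm_eq_integral_norm]
  have hrep : ∀ ψ ∈ l1Orbit h (toL1Dual lam f), ∃ a : Lp ℂ 1 lam, ‖a‖ ≤ 1 ∧
      ∀ y : StrongDual ℂ (StrongDual ℂ (Lp ℂ 1 lam)), y ψ = ∫ x, a x * y (A x) ∂lam := by
    rintro ψ ⟨a, ha, hψ⟩
    -- the limit along the trivial ultrafilter is the weak integral itself
    obtain ⟨η, hη⟩ := exists_tendsto_average_complex hAc hAn hrel (pure () : Ultrafilter Unit)
      (a := fun _ => a) (fun _ => L1.integrable_coeFn a) (Eventually.of_forall fun _ => hnorm ha)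
    have hη' : ∀ y : StrongDual ℂ (StrongDual ℂ (Lp ℂ 1 lam)),
        y η = ∫ x, a x * y (A x) ∂lam := fun y =>
      tendsto_nhds_unique (hη y) tendsto_const_nhds
    have : ψ = η := ContinuousLinearMap.ext fun b => by
      rw [hψ, toL1Dual_l1Conv]
      exact (hη' (NormedSpace.inclusionInDoubleDual ℂ _ b)).symm
    exact ⟨a, ha, fun y => by rw [this, hη']⟩
  choose! a ha hay using hrep
  refine isRelWeaklyCompact_of_ultrafilter (isBounded_l1Orbit h _) fun 𝒰 h𝒰 => ?_
  obtain ⟨η, hη⟩ := exists_tendsto_average_complex hAc hAn hrel 𝒰 (a := fun ψ => a ψ)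
    (fun ψ => L1.integrable_coeFn (a ψ)) (by filter_upwards [h𝒰] with ψ hψ using hnorm (ha ψ hψ))
  refine ⟨η, fun y => (hη y).congr' ?_⟩
  filter_upwards [h𝒰] with ψ hψ using (hay ψ hψ y).symm

/-- Every weakly almost periodic functional on `L¹(H)` is given by a bounded continuous function. -/
theorem exists_eq_toL1Dual_of_mem_WAP (h : IsLeftHaar lam) {φ : StrongDual ℂ (Lp ℂ 1 lam)}
    (hφ : φ ∈ WAP h) : ∃ f, toL1Dual lam f = φ := by
  have := h.regular
  by_contra hne
  have hcl : IsClosed ((LinearMap.range (toL1DualLI h).toLinearMap : Submodule ℂ _) :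
      Set (StrongDual ℂ (Lp ℂ 1 lam))) :=
    (toL1DualLI h).isometry.isUniformInducing.isComplete_range.isClosed
  obtain ⟨ξ, hξ1, hξ0, hξφ⟩ := exists_strongDual_eq_zero_of_notMem hcl (x := φ) hne
  obtain ⟨𝒰, h𝒰, hξ⟩ := exists_ultrafilter_tendsto_bidual ξ hξ1
  obtain ⟨ψ, -, hψ⟩ := IsRelWeaklyCompact.exists_tendsto hφ 𝒰 (u := fun a => φ.comp (l1ConvL h a))
    (by
      filter_upwards [h𝒰] with a ha
      exact subset_closure ⟨_, comp_l1ConvL_mem_l1Orbit h φ (mem_closedBall_zero_iff.1 ha), rfl⟩)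
  have hψ0 : ∀ b, ψ (ccToL1 lam b) = 0 := fun b => by
    refine (tendsto_nhds_unique (hψ (NormedSpace.inclusionInDoubleDual ℂ _ (ccToL1 lam b)))
      ((hξ (toL1Dual lam (dualOrbitFun h φ b))).congr fun a => ?_)).trans
      (hξ0 _ ⟨dualOrbitFun h φ b, rfl⟩)
    exact (apply_l1Conv_ccToL1 h φ a b).symm
  -- a weak* limit of symmetric bump functions at `e`, that is, of an approximate identity
  have := bumpFilter_inf_symm_neBot h
  set ℱ := bumpFilter lam (e : H) ⊓ 𝓟 {k | ∀ t, k (invol t) = k t}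
  have hℱ : ∀ V ∈ 𝓝 (e : H), ∀ᶠ k in Ultrafilter.of ℱ,
      IsBump lam V k ∧ ∀ t, k (invol t) = k t := fun V hV =>
    Ultrafilter.of_le ℱ (inter_mem_inf (eventually_isBump hV) (mem_principal_self _))
  obtain ⟨κ, hκ⟩ := exists_bidual_tendsto (Ultrafilter.of ℱ)
    (u := fun k => ccToL1 lam (ccOfReal k)) (by
      filter_upwards [hℱ univ univ_mem] with k hk using hk.1.norm_ccToL1.le)
  have hκT : ∀ a, κ (φ.comp (l1ConvL h a)) = φ a := fun a => by
    refine tendsto_nhds_unique (hκ _) ((φ.continuous.tendsto a).comp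
      (Metric.tendsto_nhds.2 fun ε hε => ?_))
    obtain ⟨V, hV, hVk⟩ := exists_nhds_norm_l1Conv_sub_le h a (half_pos hε)
    filter_upwards [hℱ V hV] with k hk
    rw [dist_eq_norm]
    exact (hVk k hk.1 hk.2).trans_lt (half_lt_self hε)
  have hκψ : κ ψ = 0 :=
    tendsto_nhds_unique (hκ ψ) (tendsto_const_nhds.congr fun k => (hψ0 _).symm)
  refine hξφ (tendsto_nhds_unique (hξ φ) ?_)
  rw [← hκψ]
  exact (hψ κ).congr hκT

theorem mem_wap_of_toL1Dual_mem_WAP (h : IsLeftHaar lam) {f : H →ᵇ ℂ}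
    (hf : toL1Dual lam f ∈ WAP h) : f ∈ wap H := by
  have := h.regular
  refine isRelWeaklyCompact_of_image_linearIsometry
    ((Metric.isBounded_closedBall (x := 0) (r := ‖f‖)).subset (range_subset_iff.2 fun x =>
      mem_closedBall_zero_iff.2 (norm_leftTranslate_le x f))) (toL1DualLI h)
    (IsRelWeaklyCompact.of_mem_closure hf ?_)
  rintro _ ⟨_, ⟨x, rfl⟩, rfl⟩
  have := bumpFilter_neBot h x
  have hle := Ultrafilter.of_le (bumpFilter lam x)
  obtain ⟨ψ, hψcl, hψ⟩ := IsRelWeaklyCompact.exists_tendsto hf (Ultrafilter.of (bumpFilter lam x))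
    (u := fun k => (toL1Dual lam f).comp (l1ConvL h (ccToL1 lam (ccOfReal k)))) (by
      filter_upwards [hle (eventually_isBump univ_mem)] with k hk
      exact subset_closure ⟨_, comp_l1ConvL_mem_l1Orbit h _ (IsBump.norm_ccToL1 hk).le, rfl⟩)
  have : ψ = toL1Dual lam (leftTranslate x f) := ContinuousLinearMap.ext fun b => by
    refine tendsto_nhds_unique (hψ (NormedSpace.inclusionInDoubleDual ℂ _ b))
      (((tendsto_toL1Dual_bump (lam := lam) (orbitFun f b) x).mono_left hle).congr fun k => ?_)
    exact (toL1Dual_l1Conv h f _ b).symm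
  rw [← coe_toL1DualLI h] at this
  rwa [this] at hψcl

end LCHypergroup

theorem mainTheorem10 {H : Type*} [TopologicalSpace H] [T2Space H] [LocallyCompactSpace H]
    [MeasurableSpace H] [BorelSpace H] [LCHypergroup H] {lam : Measure H}
    (h : LCHypergroup.IsLeftHaar lam) :
    Function.Injective (LCHypergroup.toL1Dual lam) ∧
      LCHypergroup.WAP h = LCHypergroup.toL1Dual lam '' LCHypergroup.wap H := by
  refine ⟨(LCHypergroup.toL1DualLI h).injective, Set.Subset.antisymm (fun φ hφ => ?_) ?_⟩
  · obtain ⟨f, rfl⟩ := LCHypergroup.exists_eq_toL1Dual_of_mem_WAP h hφ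
    exact ⟨f, LCHypergroup.mem_wap_of_toL1Dual_mem_WAP h hφ, rfl⟩
  · rintro _ ⟨f, hf, rfl⟩
    exact LCHypergroup.toL1Dual_mem_WAP h hf
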